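/- Let $\mathcal T$ be a homogeneous tree of order $q\ge 1$ (an acyclic connected graph in which every node belongs to exactly $q+1$ edges), with a fixed boundary point, that is, an equivalence class of infinite non-backtracking paths, two paths being equivalent if they coincide up to finitely many edges. For nodes $s,t$ let $s\wedge t$ be the first common node of the representatives of this boundary point that begin at $s$ and at $t$ and coincide from that node on. Write $s\preceq t$ if $\mathrm{dist}(s,s\wedge t)\le \mathrm{dist}(t,s\wedge t)$, and $s\asymp t$ if equality holds. Fix primitive shifts $\alpha_1,\dots,\alpha_q:\mathcal T\to\mathcal T$, acting on the right, with $\{t\alpha_1,\dots,t\alpha_q\}=\{s: t\preceq s,\ \mathrm{dist}(t,s)=1\}$ for every node $t$. They act on $\ell_2(\mathcal T)$ by $(\alpha_jf)(t)=f(t\alpha_j)$; let $\alpha:\ell_2(\mathcal T)\to\ell_2(\mathcal T)^q$ be the column with entries $\alpha_1,\dots,\alpha_q$. A word $w=\alpha_{i_1}\cdots\alpha_{i_n}$ has length $|w|=n$ and acts by $(wf)(t)=f(tw)$. A bounded operator $S$ on $\ell_2(\mathcal T)$ is causal if, for every node $s$ and every $f$ vanishing at all $t\preceq s$, $Sf$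 vanishes at all $t\preceq s$. Let $\mathcal C$ be the set of all $S$ such that $S$ and $S^*$ are causal, and let $\mathbf H_2(\mathcal T)$ be the space of causal operators $F$ with $\|F\|_2^2=\mathrm{trace}(F^*F)<\infty$. For a $q$-tuple (column) $G=(G_1,\dots,G_q)\in\mathbf H_2(\mathcal T)^q$ put $\|G\|_2^2=\sum_j\|G_j\|_2^2$. Let $\mathbb B(\mathcal T)$ be the set of rows $c=(c_1,\dots,c_q)\in\mathcal C^q$ with $\lim_{n\to\infty}\|(c\alpha)^n\|^{1/n}<1$, where $c\alpha=\sum_jc_j\alpha_j$. For a causal operator $S$ and a word $w$, let $S_{[w]}\in\mathcal C$ be the operator with $(S_{[w]}\chi_t)(s)=(S\chi_t)(sw)$ if $t\asymp s$ and $(S_{[w]}\chi_t)(s)=0$ otherwise, where $\chi_t$ is the standard basis of $\ell_2(\mathcal T)$. For $c\in\mathbb B(\mathcal T)$ put $$S^\wedge(c)=\sum_{n=0}^\infty (c\alpha)^n\sum_{|w|=n}w^*S_{[w]},$$ $$R_c=\sum_{n=0}^\infty(c\alpha)^n(\alpha^*c^*)^n,\qquad L_c=\alpha\bigl(R_c-R_c\alpha^*c^*R_c^{-1}c\alpha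 R_c\bigr)\alpha^*,\qquad B_c=(\alpha^*-c)(I-L_cc^*\alpha^*)^{-1}\sqrt{L_c},$$ so that $B_c$, the Blaschke factor attached to $c$, maps $\ell_2(\mathcal T)^q$ to $\ell_2(\mathcal T)$. **Theorem.** Let $c\in\mathbb B(\mathcal T)$. Then $B_c$ is unitary, that is, $B_c^*B_c=I$ and $B_cB_c^*=I$. Moreover, for every $F\in\mathbf H_2(\mathcal T)$ the series defining $F^\wedge(c)$ converges absolutely in the operator norm, and $F^\wedge(c)=0$ if and only if there is $G\in\mathbf H_2(\mathcal T)^q$ with $F=B_cG$ and $\|G\|_2=\|F\|_2$. -/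

import Mathlib

open Filter Topology

namespace Multiscale

/-! ### Infinite paths, boundary points, the ordering of the tree -/

/-- An infinite path without backtracking in a graph. -/
structure Ray {V : Type*} (G : SimpleGraph V) where
  node : ℕ → V
  adj : ∀ k, G.Adj (node k) (node (k + 1))
  ne : ∀ k, node k ≠ node (k + 2)

section Rays

variable {V : Type*} {G : SimpleGraph V}

/-- From the indices `m` and `n` on, the paths `p` and `r` coincide. -/
def Merge (p r : Ray G) (m n : ℕ) : Prop := ∀ k, p.node (m + k) = r.node (n + k)

/-- Two paths are equivalent if they coincide modulo a finite number of edges. -/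
instance raySetoid (G : SimpleGraph V) : Setoid (Ray G) where
  r p r := ∃ m n, Merge p r m n
  iseqv :=
    { refl := fun _ => ⟨0, 0, fun _ => rfl⟩
      symm := fun ⟨m, n, h⟩ => ⟨n, m, fun k => (h k).symm⟩
      trans := by
        rintro x y z ⟨m, n, h⟩ ⟨m', n', h'⟩
        refine ⟨m + m', n' + n, fun k => ?_⟩
        have h1 := h (m' + k)
        have h2 := h' (n + k)
        rw [show m + m' + k = m + (m' + k) by ring, show n' + n + k = n' + (n + k) by ring,
          h1, ← h2]
        congr 1; ring }

/-- The boundary points of a graph: the equivalence classes of infinite paths. -/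
def Boundary (G : SimpleGraph V) : Type _ := Quotient (raySetoid G)

/-- The infinite path `p` begins at the node `t` and represents the boundary point `ω`. -/
def Represents (ω : Boundary G) (t : V) (p : Ray G) : Prop :=
  p.node 0 = t ∧ Quotient.mk (raySetoid G) p = ω

/-- `u = s ∧ t`: the representatives of `ω` that begin at `s` and at `t` coincide from `u` on, and
`u` is the first such node. -/
def IsMeet (ω : Boundary G) (s t u : V) : Prop :=
  ∃ p r : Ray G, Represents ω s p ∧ Represents ω t r ∧
    ∃ m n, p.node m = u ∧ r.node n = u ∧ Merge p r m n ∧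
      ∀ m' n', Merge p r m' n' → m ≤ m' ∧ n ≤ n'

/-- `s ⪯ t`, that is, `dist (s, s ∧ t) ≤ dist (t, s ∧ t)`. -/
def Prec (ω : Boundary G) (s t : V) : Prop :=
  ∃ u, IsMeet ω s t u ∧ G.dist s u ≤ G.dist t u

/-- `s ≍ t`, that is, `dist (s, s ∧ t) = dist (t, s ∧ t)`; the classes are the horocycles. -/
def Horo (ω : Boundary G) (s t : V) : Prop :=
  ∃ u, IsMeet ω s t u ∧ G.dist s u = G.dist t u

/-- The beginning of an infinite path, as a walk. -/
def Ray.walk (p : Ray G) : ∀ n, G.Walk (p.node 0) (p.node n)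
  | 0 => .nil
  | n + 1 => (p.walk n).concat (p.adj n)

lemma Ray.support_walk (p : Ray G) (n : ℕ) :
    (p.walk n).support = (List.range (n + 1)).map p.node := by
  induction n with
  | zero => simp [Ray.walk]
  | succ n ih => rw [Ray.walk, SimpleGraph.Walk.support_concat, ih, List.range_succ (n := n + 1)]; simp

lemma Ray.edges_walk (p : Ray G) (n : ℕ) :
    (p.walk n).edges = (List.range n).map (fun k => s(p.node k, p.node (k + 1))) := by
  induction n with
  | zero => simp [Ray.walk]
  | succ n ih => rw [Ray.walk, SimpleGraph.Walk.edges_concat, ih, List.range_succ]; simp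

lemma Ray.isPath_walk (hG : G.IsTree) (p : Ray G) (n : ℕ) : (p.walk n).IsPath := by
  rw [hG.isAcyclic.isPath_iff_isChain, p.edges_walk, List.isChain_iff_getElem]
  intro i hi
  simp only [List.getElem_map, List.getElem_range, ne_eq, Sym2.eq_iff, not_or, not_and]
  exact ⟨fun h => absurd h (p.adj i).ne, fun h => absurd h (p.ne i)⟩

lemma Ray.length_walk (p : Ray G) (n : ℕ) : (p.walk n).length = n := by
  have h := congrArg List.length (p.support_walk n)
  simpa using h

lemma Ray.injective (hG : G.IsTree) (p : Ray G) : Function.Injective p.node := by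
  intro i j hij
  have h := (p.isPath_walk hG (max i j)).support_nodup
  rw [p.support_walk] at h
  exact List.inj_on_of_nodup_map h (by simp) (by simp) hij

lemma support_eq_of_isPath (hG : G.IsTree) {a b a' b' : V} (ha : a = a') (hb : b = b')
    {w : G.Walk a b} {w' : G.Walk a' b'} (hw : w.IsPath) (hw' : w'.IsPath) :
    w.support = w'.support := by
  subst ha hb
  rw [(hG.existsUnique_path a b).unique hw hw']

lemma Ray.dist_node (hG : G.IsTree) (p : Ray G) (n : ℕ) : G.dist (p.node 0) (p.node n) = n := by
  obtain ⟨w, hw, hl⟩ := (hG.connected (p.node 0) (p.node n)).exists_path_of_dist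
  rw [← hl, (hG.existsUnique_path _ _).unique hw (p.isPath_walk hG n), p.length_walk]

/-- Each boundary point has at most one representative that begins at a given node. -/
lemma Ray.unique (hG : G.IsTree) {ω : Boundary G} {t : V} {p r : Ray G}
    (hp : Represents ω t p) (hr : Represents ω t r) : p = r := by
  obtain ⟨m, n, h⟩ : ∃ m n, Merge p r m n := Quotient.exact (hp.2.trans hr.2.symm)
  have key : ∀ k, (List.range (m + k + 1)).map p.node = (List.range (n + k + 1)).map r.node := by
    intro k
    rw [← p.support_walk, ← r.support_walk]
    exact support_eq_of_isPath hG (hp.1.trans hr.1.symm) (h k) (p.isPath_walk hG _)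
      (r.isPath_walk hG _)
  have hmn : m = n := by simpa using congrArg List.length (key 0)
  subst hmn
  have hn : p.node = r.node := by
    funext i
    exact List.map_inj_left.1 (key i) i (by simp)
  cases p; cases r; cases hn; rfl

/-- Each boundary point has a representative that begins at a neighbour of the first node of a
given representative. -/
lemma Ray.step {ω : Boundary G} {t u : V} {p : Ray G} (hp : Represents ω t p) (hu : G.Adj u t) :
    ∃ r, Represents ω u r ∧ (Merge p r 1 0 ∨ Merge p r 0 1) := by
  obtain ⟨rfl, hω⟩ := hp
  by_cases h : p.node 1 = u
  · have hm : Merge p (Ray.mk (fun k => p.node (1 + k)) (fun k => p.adj _) (fun k => p.ne _)) 1 0 := by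
      intro k; simp
    refine ⟨_, ⟨h, ?_⟩, Or.inl hm⟩
    rw [← hω]
    exact (Quotient.sound (s := raySetoid G) (Exists.intro _ (Exists.intro _ hm))).symm
  · have hm : Merge p (Ray.mk (fun k => Nat.casesOn k u p.node) (fun k => by cases k; exacts [hu, p.adj _])
        (fun k => by cases k; exacts [fun e => h e.symm, p.ne _])) 0 1 := by
      intro k; simp [add_comm 1 k]
    refine ⟨_, ⟨rfl, ?_⟩, Or.inr hm⟩
    rw [← hω]
    exact (Quotient.sound (s := raySetoid G) (Exists.intro _ (Exists.intro _ hm))).symm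

lemma exists_represents (hG : G.IsTree) (ω : Boundary G) (t : V) : ∃ p, Represents ω t p := by
  obtain ⟨p₀, hp₀⟩ := Quotient.exists_rep ω
  obtain ⟨w⟩ := hG.connected t (p₀.node 0)
  generalize hv : p₀.node 0 = v at w
  induction w with
  | nil => exact ⟨p₀, hv, hp₀⟩
  | cons h _ ih =>
    obtain ⟨r, hr⟩ := ih hv
    obtain ⟨r', hr', -⟩ := Ray.step hr h
    exact ⟨r', hr'⟩

lemma Merge.add_eq (hG : G.IsTree) {p r : Ray G} {a b m n : ℕ} (h : Merge p r a b)
    (h' : Merge p r m n) : a + n = b + m := by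
  have h1 := h m
  have h2 := h' a
  rw [add_comm m a, h1] at h2
  have := r.injective hG h2
  omega

lemma exists_isMeet (hG : G.IsTree) {ω : Boundary G} {s t : V} {p r : Ray G}
    (hp : Represents ω s p) (hr : Represents ω t r) {a b : ℕ} (h : Merge p r a b) :
    ∃ u, IsMeet ω s t u := by
  classical
  have ex : ∃ m, ∃ n, Merge p r m n := ⟨a, b, h⟩
  obtain ⟨n, hn⟩ := Nat.find_spec ex
  refine ⟨r.node n, p, r, hp, hr, Nat.find ex, n, by simpa using hn 0, rfl, hn, ?_⟩
  intro m' n' h'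
  have h1 : Nat.find ex ≤ m' := Nat.find_min' ex ⟨n', h'⟩
  have h2 := Merge.add_eq hG hn h'
  omega

lemma IsMeet.dist_eq (hG : G.IsTree) {ω : Boundary G} {s t u : V} {p r : Ray G}
    (hp : Represents ω s p) (hr : Represents ω t r) {a b : ℕ} (h : Merge p r a b)
    (hu : IsMeet ω s t u) : a + G.dist t u = b + G.dist s u := by
  obtain ⟨p', r', hp', hr', m, n, hm, hn, hmn, -⟩ := hu
  obtain rfl := Ray.unique hG hp hp'
  obtain rfl := Ray.unique hG hr hr'
  have h1 := p.dist_node hG m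
  have h2 := r.dist_node hG n
  rw [hp.1, hm] at h1
  rw [hr.1, hn] at h2
  rw [h1, h2]
  exact Merge.add_eq hG h hmn

lemma prec_iff (hG : G.IsTree) {ω : Boundary G} {s t : V} {p r : Ray G}
    (hp : Represents ω s p) (hr : Represents ω t r) {a b : ℕ} (h : Merge p r a b) :
    Prec ω s t ↔ a ≤ b := by
  constructor
  · rintro ⟨u, hu, hle⟩
    have := hu.dist_eq hG hp hr h
    omega
  · intro hab
    obtain ⟨u, hu⟩ := exists_isMeet hG hp hr h
    have := hu.dist_eq hG hp hr h
    exact ⟨u, hu, by omega⟩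

lemma horo_iff (hG : G.IsTree) {ω : Boundary G} {s t : V} {p r : Ray G}
    (hp : Represents ω s p) (hr : Represents ω t r) {a b : ℕ} (h : Merge p r a b) :
    Horo ω s t ↔ a = b := by
  constructor
  · rintro ⟨u, hu, hle⟩
    have := hu.dist_eq hG hp hr h
    omega
  · intro hab
    obtain ⟨u, hu⟩ := exists_isMeet hG hp hr h
    have := hu.dist_eq hG hp hr h
    exact ⟨u, hu, by omega⟩

lemma horo_equivalence (hG : G.IsTree) (ω : Boundary G) : Equivalence (Horo ω) := by
  have ex : ∀ p r : Ray G, Quotient.mk (raySetoid G) p = ω → Quotient.mk (raySetoid G) r = ω →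
      ∃ m n, Merge p r m n := fun p r hp hr => Quotient.exact (hp.trans hr.symm)
  refine ⟨fun s => ?_, fun {s t} hst => ?_, fun {s t u} hst htu => ?_⟩
  · obtain ⟨p, hp⟩ := exists_represents hG ω s
    exact (horo_iff hG hp hp (a := 0) (b := 0) (fun _ => rfl)).2 rfl
  · obtain ⟨p, hp⟩ := exists_represents hG ω s
    obtain ⟨r, hr⟩ := exists_represents hG ω t
    obtain ⟨m, n, h⟩ := ex p r hp.2 hr.2
    exact (horo_iff hG hr hp (fun k => (h k).symm)).2 ((horo_iff hG hp hr h).1 hst).symm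
  · obtain ⟨p, hp⟩ := exists_represents hG ω s
    obtain ⟨r, hr⟩ := exists_represents hG ω t
    obtain ⟨v, hv⟩ := exists_represents hG ω u
    obtain ⟨m, n, h⟩ := ex p r hp.2 hr.2
    obtain ⟨m', n', h'⟩ := ex r v hr.2 hv.2
    obtain rfl := (horo_iff hG hp hr h).1 hst
    obtain rfl := (horo_iff hG hr hv h').1 htu
    refine (horo_iff hG hp hv (a := m + m') (b := m + m') fun k => ?_).2 rfl
    have h1 := h (m' + k)
    have h2 := h' (m + k)
    rw [show m + m' + k = m + (m' + k) by ring, h1,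
      show m + (m' + k) = m' + (m + k) by ring, h2]

end Rays

/-! ### Homogeneous trees with primitive shifts -/

/-- The standing data: a homogeneous tree of order `q` with the node set `V` (every node belongs to
exactly `q + 1` edges), a fixed boundary point, and `q` primitive shifts `t ↦ t α_j`, whose values
at `t` are the nodes `s` with `t ⪯ s` and `dist (t, s) = 1`. -/
structure ShiftTree (V : Type*) (q : ℕ) where
  graph : SimpleGraph V
  isTree : graph.IsTree
  degree : ∀ t, (graph.neighborSet t).encard = q + 1
  infty : Boundary graph
  shift : Fin q → V → V
  range_shift : ∀ t, Set.range (fun j => shift j t) =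
    {s | Prec infty t s ∧ graph.dist t s = 1}

/-- The Hilbert space `ℓ₂` of square summable functions on `V`. -/
noncomputable abbrev L2 (V : Type*) := lp (fun _ : V => ℂ) 2

/-- The Hilbert space `ℓ₂^q` of columns. -/
abbrev L2q (V : Type*) (q : ℕ) := PiLp 2 (fun _ : Fin q => L2 V)

/-- Bounded linear operators on `ℓ₂`. -/
abbrev Op (V : Type*) := L2 V →L[ℂ] L2 V

section Operators

variable {V : Type*}

lemma sum_sq_le (f : L2 V) (s : Finset V) : ∑ t ∈ s, ‖f t‖ ^ 2 ≤ ‖f‖ ^ 2 := by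
  have h := lp.sum_rpow_le_norm_rpow (p := 2) (by norm_num) f s
  simpa using h

lemma memℓp_of_sum {f : V → ℂ} {C : ℝ} (h : ∀ s : Finset V, ∑ t ∈ s, ‖f t‖ ^ 2 ≤ C) :
    Memℓp f 2 := by
  refine memℓp_gen' (C := C) fun s => ?_
  simpa using h s

lemma norm_le_of_sum {f : L2 V} {C : ℝ} (hC : 0 ≤ C)
    (h : ∀ s : Finset V, ∑ t ∈ s, ‖f t‖ ^ 2 ≤ C ^ 2) : ‖f‖ ≤ C := by
  refine lp.norm_le_of_forall_sum_le (p := 2) (by norm_num) hC fun s => ?_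
  simpa using h s

lemma sum_comp_le {a : V → V} (ha : Function.Injective a) (f : L2 V) (s : Finset V) :
    ∑ t ∈ s, ‖f (a t)‖ ^ 2 ≤ ‖f‖ ^ 2 := by
  have h := sum_sq_le f (s.map ⟨a, ha⟩)
  simpa using h

/-- The operator `f ↦ f ∘ a` on `ℓ₂`, for an injective map `a`. -/
noncomputable def compOp (a : V → V) (ha : Function.Injective a) : Op V :=
  LinearMap.mkContinuous
    { toFun := fun f => ⟨fun t => f (a t), memℓp_of_sum (sum_comp_le ha f)⟩
      map_add' := fun _ _ => rfl
      map_smul' := fun _ _ => rfl } 1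
    (fun f => by
      rw [one_mul]
      exact norm_le_of_sum (norm_nonneg _) (sum_comp_le ha f))

open Classical in
lemma sum_indicator_le (A : Set V) (f : L2 V) (s : Finset V) :
    ∑ t ∈ s, ‖A.indicator f t‖ ^ 2 ≤ ‖f‖ ^ 2 := by
  refine le_trans (Finset.sum_le_sum fun t _ => ?_) (sum_sq_le f s)
  gcongr
  exact norm_indicator_le_norm_self _ _

/-- The orthogonal projection `f ↦ 1_A f` on `ℓ₂`. -/
noncomputable def restrictOp (A : Set V) : Op V :=
  LinearMap.mkContinuous
    { toFun := fun f => ⟨A.indicator f, memℓp_of_sum (sum_indicator_le A f)⟩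
      map_add' := fun f g => by
        ext t
        exact congrFun (Set.indicator_add A f g) t
      map_smul' := fun c f => by
        ext t
        exact congrFun (Set.indicator_const_smul A c f) t } 1
    (fun f => by
      rw [one_mul]
      exact norm_le_of_sum (norm_nonneg _) (sum_indicator_le A f))

lemma restrictOp_apply (A : Set V) (f : L2 V) (t : V) : restrictOp A f t = A.indicator f t := rfl

open Classical in
/-- The standard basis vector `χ_t` of `ℓ₂`. -/
noncomputable def chi (t : V) : L2 V := lp.single 2 t 1

lemma summable_sq (f : L2 V) : Summable fun t => ‖f t‖ ^ 2 := by
  simpa using (lp.memℓp f).summable (by norm_num)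

lemma norm_sq_eq (f : L2 V) : ‖f‖ ^ 2 = ∑' t, ‖f t‖ ^ 2 := by
  simpa using lp.norm_rpow_eq_tsum (p := 2) (by norm_num) f

lemma sum_restrict_le (r : Setoid V) (f : L2 V) (H : Finset (Quotient r)) :
    ∑ h ∈ H, ‖restrictOp {s | (Quotient.mk r s) = h} f‖ ^ 2 ≤ ‖f‖ ^ 2 := by
  classical
  simp_rw [norm_sq_eq]
  rw [← Summable.tsum_finsetSum fun h _ => summable_sq _]
  refine Summable.tsum_le_tsum (fun t => ?_) (summable_sum fun h _ => summable_sq _)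
    (summable_sq f)
  have : ∀ h, ‖restrictOp {s | (Quotient.mk r s) = h} f t‖ ^ 2 =
      if Quotient.mk r t = h then ‖f t‖ ^ 2 else 0 := by
    intro h
    rw [restrictOp_apply, Set.indicator_apply]
    simp only [Set.mem_ofPred_eq]
    split_ifs <;> simp
  simp_rw [this]
  rw [Finset.sum_ite_eq]
  split_ifs
  · exact le_rfl
  · positivity

lemma sum_diag_le (r : Setoid V) (A : Op V) (f : L2 V) (s : Finset V) :
    ∑ t ∈ s, ‖A (restrictOp {x | r x t} f) t‖ ^ 2 ≤ (‖A‖ * ‖f‖) ^ 2 := by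
  classical
  have e : ∀ t : V, {x | r x t} = {x | Quotient.mk r x = Quotient.mk r t} := fun t => by
    ext x
    exact Quotient.eq.symm
  rw [← Finset.sum_fiberwise_of_maps_to (t := s.image (Quotient.mk r)) (g := Quotient.mk r)
    (fun t ht => Finset.mem_image_of_mem _ ht)]
  calc _ ≤ ∑ h ∈ s.image (Quotient.mk r), (‖A‖ * ‖restrictOp {x | Quotient.mk r x = h} f‖) ^ 2 := by
        refine Finset.sum_le_sum fun h _ => ?_
        refine le_trans (le_of_eq (Finset.sum_congr rfl
          (g := fun t => ‖A (restrictOp {x | Quotient.mk r x = h} f) t‖ ^ 2) fun t ht => ?_))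
          ((sum_sq_le _ _).trans ?_)
        · rw [e, (Finset.mem_filter.1 ht).2]
        · gcongr
          exact A.le_opNorm _
    _ ≤ _ := by
        simp_rw [mul_pow]
        rw [← Finset.mul_sum]
        gcongr
        exact sum_restrict_le r f _

/-- The block diagonal part of the bounded operator `A` with respect to an equivalence relation on
the index set: the `(s, t)` entry of its matrix is that of `A` if `s` and `t` are equivalent, and
`0` otherwise. -/
noncomputable def blockDiag (r : Setoid V) (A : Op V) : Op V :=
  LinearMap.mkContinuous
    { toFun := fun f => ⟨fun t => A (restrictOp {x | r x t} f) t,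
        memℓp_of_sum (sum_diag_le r A f)⟩
      map_add' := fun f g => by
        ext t
        change A (restrictOp _ (f + g)) t = _
        rw [map_add, map_add]; rfl
      map_smul' := fun c f => by
        ext t
        change A (restrictOp _ (c • f)) t = _
        rw [map_smul, map_smul]; rfl } ‖A‖
    (fun f => norm_le_of_sum (by positivity) (sum_diag_le r A f))

lemma restrictOp_chi (A : Set V) (t : V) [Decidable (t ∈ A)] :
    restrictOp A (chi t) = if t ∈ A then chi t else 0 := by
  classical
  ext s
  rw [restrictOp_apply, Set.indicator_apply]
  by_cases hst : s = t
  · subst hst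
    split_ifs <;> rfl
  · have h0 : chi t s = 0 := by
      unfold chi
      rw [lp.single_apply_ne _ _ _ hst]
    split_ifs <;> simp [h0]

/-- The trace of a positive operator, a sum over the standard basis with values in `[0, ∞]`. -/
noncomputable def trace (A : Op V) : ENNReal :=
  ∑' t, ENNReal.ofReal (RCLike.re (inner ℂ (chi t) (A (chi t))))

/-- The Hilbert–Schmidt norm: `‖F‖₂² = trace (F* F)`, with values in `[0, ∞]`. -/
noncomputable def hsNorm (F : Op V) : ENNReal :=
  (trace (ContinuousLinearMap.adjoint F * F)) ^ (1 / 2 : ℝ)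

variable {q : ℕ}

/-- The Hilbert–Schmidt norm of a `q`-tuple: `‖G‖₂² = ‖G_1‖₂² + ... + ‖G_q‖₂²`. -/
noncomputable def hsNormTuple (G : Fin q → Op V) : ENNReal :=
  (∑ j, hsNorm (G j) ^ 2) ^ (1 / 2 : ℝ)

/-- A `q`-tuple of operators as a column: `f ↦ (G_1 f, ..., G_q f)`. -/
noncomputable def colOp (G : Fin q → Op V) : L2 V →L[ℂ] L2q V q :=
  ((PiLp.continuousLinearEquiv 2 ℂ (fun _ : Fin q => L2 V)).symm :
    ((_ : Fin q) → L2 V) →L[ℂ] L2q V q) ∘L ContinuousLinearMap.pi G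

/-- A `q`-tuple of operators as a row: `(f_1, ..., f_q) ↦ c_1 f_1 + ... + c_q f_q`. -/
noncomputable def rowOp (c : Fin q → Op V) : L2q V q →L[ℂ] L2 V :=
  ∑ j, c j ∘L PiLp.proj 2 (fun _ : Fin q => L2 V) j

/-- The positive square root of a positive operator. -/
noncomputable def opSqrt {H : Type*} [NormedAddCommGroup H] [InnerProductSpace ℂ H]
    [CompleteSpace H] (A : H →L[ℂ] H) : H →L[ℂ] H := CFC.sqrt A

end Operators

namespace ShiftTree

variable {V : Type*} {q : ℕ} (T : ShiftTree V q)

/-- Each node `u` has only one neighbour `t` with `t ⪯ u`: the next node on the path from `u` to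
the boundary point. -/
lemma shift_injective (j : Fin q) : Function.Injective (T.shift j) := by
  have key : ∀ t, ∃ r, Represents T.infty (T.shift j t) r ∧ r.node 1 = t := by
    intro t
    have hm : T.shift j t ∈ {s | Prec T.infty t s ∧ T.graph.dist t s = 1} := by
      rw [← T.range_shift t]
      exact ⟨j, rfl⟩
    obtain ⟨hp, hd⟩ := hm
    obtain ⟨p, hpt⟩ := exists_represents T.isTree T.infty t
    obtain ⟨r, hr, h | h⟩ := Ray.step hpt (SimpleGraph.dist_eq_one_iff_adj.1 hd).symm
    · have := (prec_iff T.isTree hpt hr h).1 hp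
      omega
    · exact ⟨r, hr, by rw [← hpt.1]; exact (h 0).symm⟩
  intro t t' htt
  obtain ⟨r, hr, h⟩ := key t
  obtain ⟨r', hr', h'⟩ := key t'
  rw [← htt] at hr'
  rw [← h, ← h', Ray.unique T.isTree hr hr']

/-- The partition of the nodes into horocycles. -/
def horocycles : Setoid V := ⟨Horo T.infty, horo_equivalence T.isTree T.infty⟩

/-- The primitive shift as an operator: `(α_j f)(t) = f(t α_j)`. -/
noncomputable def alpha (j : Fin q) : Op V := compOp (T.shift j) (T.shift_injective j)

/-- The column `α` of the primitive shifts. -/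
noncomputable def alphaCol : L2 V →L[ℂ] L2q V q := colOp T.alpha

/-- The operator of the word `α_{i_1} ... α_{i_n}`. -/
noncomputable def word (w : List (Fin q)) : Op V := (w.map T.alpha).prod

/-- The node `t w`, for the word `w = α_{i_1} ... α_{i_n}`. -/
def act (t : V) (w : List (Fin q)) : V := w.foldl (fun s j => T.shift j s) t

lemma word_apply (w : List (Fin q)) (f : L2 V) (t : V) : T.word w f t = f (T.act t w) := by
  induction w generalizing t with
  | nil => simp [word, act]
  | cons j w ih =>
    have h : T.word (j :: w) = T.alpha j * T.word w := by simp [word]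
    rw [h]
    exact ih (T.shift j t)

/-- Causal operators. -/
def IsCausal (S : Op V) : Prop :=
  ∀ (s : V) (f : L2 V), (∀ t, Prec T.infty t s → f t = 0) → ∀ t, Prec T.infty t s → S f t = 0

/-- Constants: `S` and its adjoint are causal. -/
def IsConst (S : Op V) : Prop := T.IsCausal S ∧ T.IsCausal (ContinuousLinearMap.adjoint S)

/-- The space `H₂` of causal Hilbert–Schmidt operators. -/
def H2 : Set (Op V) := {F | T.IsCausal F ∧ hsNorm F < ⊤}

/-- The coefficient `S_[w]` of the expansion `S = ∑ w* S_[w]` of a causal operator; its matrix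
entries are computed in `coeff_chi`. -/
noncomputable def coeff (S : Op V) (w : List (Fin q)) : Op V :=
  blockDiag T.horocycles (T.word w * S)

open Classical in
lemma coeff_chi (S : Op V) (w : List (Fin q)) (s t : V) :
    T.coeff S w (chi t) s = if Horo T.infty t s then S (chi t) (T.act s w) else 0 := by
  change (T.word w * S) (restrictOp {x | Horo T.infty x s} (chi t)) s = _
  rw [restrictOp_chi]
  by_cases h : Horo T.infty t s
  · simp only [Set.mem_ofPred_eq, h, if_true]
    exact T.word_apply w _ s
  · simp [h]

/-- The operator `c α = c_1 α_1 + ... + c_q α_q`. -/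
noncomputable def cAlpha (c : Fin q → Op V) : Op V := rowOp c ∘L T.alphaCol

/-- The analogue of the unit disk: the rows `c` of constants with `lim ‖(c α)^n‖^(1/n) < 1`. -/
def ball : Set (Fin q → Op V) :=
  {c | (∀ j, T.IsConst (c j)) ∧
    ∃ ρ < 1, Tendsto (fun n : ℕ => ‖T.cAlpha c ^ n‖ ^ (1 / (n : ℝ))) atTop (𝓝 ρ)}

/-- The `n`-th term `(c α)^n ∑_{|w| = n} w* S_[w]` of the point evaluation. -/
noncomputable def pointEvalTerm (S : Op V) (c : Fin q → Op V) (n : ℕ) : Op V :=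
  T.cAlpha c ^ n * ∑ w : Fin n → Fin q,
    ContinuousLinearMap.adjoint (T.word (List.ofFn w)) * T.coeff S (List.ofFn w)

/-- The point evaluation `S^∧(c)`, a series in the operator norm. -/
noncomputable def pointEval (S : Op V) (c : Fin q → Op V) : Op V :=
  ∑' n, T.pointEvalTerm S c n

/-- `R_c = ∑ (c α)^n (α* c*)^n`. -/
noncomputable def R (c : Fin q → Op V) : Op V :=
  ∑' n : ℕ, T.cAlpha c ^ n *
    (ContinuousLinearMap.adjoint T.alphaCol ∘L ContinuousLinearMap.adjoint (rowOp c)) ^ n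

/-- `L_c = α (R_c - R_c α* c* R_c⁻¹ c α R_c) α*`, an operator on `ℓ₂^q`. -/
noncomputable def L (c : Fin q → Op V) : L2q V q →L[ℂ] L2q V q :=
  T.alphaCol ∘L
    (T.R c - T.R c *
      (ContinuousLinearMap.adjoint T.alphaCol ∘L ContinuousLinearMap.adjoint (rowOp c)) *
      Ring.inverse (T.R c) * T.cAlpha c * T.R c) ∘L
    ContinuousLinearMap.adjoint T.alphaCol

/-- The Blaschke factor `B_c = (α* - c) (1 - L_c c* α*)⁻¹ √L_c`, an operator from `ℓ₂^q` to
`ℓ₂`. -/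
noncomputable def blaschke (c : Fin q → Op V) : L2q V q →L[ℂ] L2 V :=
  (ContinuousLinearMap.adjoint T.alphaCol - rowOp c) ∘L
    Ring.inverse (1 - T.L c ∘L ContinuousLinearMap.adjoint (rowOp c) ∘L
      ContinuousLinearMap.adjoint T.alphaCol) ∘L
    opSqrt (T.L c)

end ShiftTree

end Multiscale

namespace Multiscale

/-! ### The level of a node -/

section Level

variable {V : Type*} {G : SimpleGraph V}

/-! Write `a = cα`. Two facts carry the proof: the column `α` is unitary, and the tree is graded by
an integer level.

Unitarity. Every node is `tα_j` for exactly one pair `(j, t)`, so `α*α = 1` and `αα* = 1`. Hence `c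
= aα*`, `L_c = α m α*` with `m = r - r a* r⁻¹ a r` and `r = R_c`, and `B_c = (1 - a) z √m α*` with
`z = (1 - m a*)⁻¹`. What remains is algebra in a C*-algebra based on `r = 1 + a r a*`: one finds
`m⁻¹ = r⁻¹ + a*a`, hence `(1 - a m) m⁻¹ (1 - m a*) = (1 - a*)(1 - a)`, and `B_c B_c* = 1` follows
(`blaschke_identity`). As `B_c` also has a left inverse, `B_c* B_c = 1`.

Interpolation. Causal operators are those whose matrix entries vanish when the target level is below
the source level. The operator `a` lowers levels by exactly one, so `F^∧(c)` is the level-preserving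
part of `(1 - a)⁻¹F`; it vanishes if and only if `(1 - a)⁻¹F` is strictly causal
(`pointEval_eq_zero_iff`). By unitarity the only candidate for `G` is `B_c*F = αQ`, where `Q = √m
r⁻¹ ((1 - a)⁻¹F - r a* F)`. Here `√m` and `r` are causal with causal inverses, and `r a* F` is
strictly causal, so `Q` is strictly causal exactly when `(1 - a)⁻¹F` is
(`raisesLevel_quotient_iff`). Finally, `Q` is strictly causal exactly when all `α_j Q` are causal
(`raisesLevel_one_iff`), and the isometry `B_c` preserves Hilbert–Schmidt norms. -/

lemma exists_merge {ω : Boundary G} {s t : V} {p r : Ray G} (hp : Represents ω s p)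
    (hr : Represents ω t r) : ∃ m n, Merge p r m n :=
  Quotient.exact (hp.2.trans hr.2.symm)

/-- This is the Busemann function of the boundary point: the difference `a - b` does not depend on
the merging indices (`Merge.add_eq`), so the level can be normalised at a base node `o`. -/
lemma exists_level (hG : G.IsTree) (ω : Boundary G) :
    ∃ lev : V → ℤ, ∀ (s t : V) (p r : Ray G) (a b : ℕ), Represents ω s p → Represents ω t r →
      Merge p r a b → lev s - lev t = a - b := by
  obtain ⟨o⟩ := hG.connected.nonempty
  choose ray hray using exists_represents hG ω
  choose m n hmn using fun t => exists_merge (hray t) (hray o)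
  refine ⟨fun t => m t - n t, fun s t p r a b hp hr h => ?_⟩
  obtain rfl := Ray.unique hG hp (hray s)
  obtain rfl := Ray.unique hG hr (hray t)
  have h' : Merge (ray s) (ray t) (m s + n t) (m t + n s) := fun k => by
    have h1 := hmn s (n t + k)
    have h2 := hmn t (n s + k)
    rw [← add_assoc] at h1 h2
    rw [h1, h2]
    congr 1
    ring
  have := Merge.add_eq hG h h'
  dsimp only
  omega

end Level

namespace ShiftTree

variable {V : Type*} {q : ℕ} (T : ShiftTree V q)

/-- The level of a node: the horocycles are the sets of nodes of a given level. -/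
noncomputable def level : V → ℤ := (exists_level T.isTree T.infty).choose

variable {T}

lemma level_sub_level {s t : V} {p r : Ray T.graph} {a b : ℕ} (hp : Represents T.infty s p)
    (hr : Represents T.infty t r) (h : Merge p r a b) : T.level s - T.level t = a - b :=
  (exists_level T.isTree T.infty).choose_spec s t p r a b hp hr h

lemma prec_iff_level {s t : V} : Prec T.infty s t ↔ T.level s ≤ T.level t := by
  obtain ⟨p, hp⟩ := exists_represents T.isTree T.infty s
  obtain ⟨r, hr⟩ := exists_represents T.isTree T.infty t
  obtain ⟨m, n, h⟩ := exists_merge hp hr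
  have := level_sub_level hp hr h
  rw [prec_iff T.isTree hp hr h]
  omega

lemma horo_iff_level {s t : V} : Horo T.infty s t ↔ T.level s = T.level t := by
  obtain ⟨p, hp⟩ := exists_represents T.isTree T.infty s
  obtain ⟨r, hr⟩ := exists_represents T.isTree T.infty t
  obtain ⟨m, n, h⟩ := exists_merge hp hr
  have := level_sub_level hp hr h
  rw [horo_iff T.isTree hp hr h]
  omega

lemma level_of_adj {s t : V} (h : T.graph.Adj s t) :
    T.level s = T.level t + 1 ∨ T.level s = T.level t - 1 := by
  obtain ⟨p, hp⟩ := exists_represents T.isTree T.infty t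
  obtain ⟨r, hr, h | h⟩ := Ray.step hp h <;> have := level_sub_level hp hr h <;> omega

/-- The next node on the path to the boundary point is the only neighbour of smaller level. -/
lemma exists_parent (t : V) : ∃ u, T.graph.Adj t u ∧ T.level t = T.level u + 1 ∧
    ∀ v, T.graph.Adj t v → T.level t = T.level v + 1 → v = u := by
  obtain ⟨p, hp⟩ := exists_represents T.isTree T.infty t
  have key : ∀ v, T.graph.Adj v t → T.level t = T.level v + 1 → v = p.node 1 := by
    intro v hv hl
    obtain ⟨r, hr, h | h⟩ := Ray.step hp hv
    · rw [← hr.1]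
      exact (h 0).symm
    · have := level_sub_level hp hr h
      omega
  have ha : T.graph.Adj t (p.node 1) := by
    have := p.adj 0
    rwa [hp.1] at this
  refine ⟨_, ha, ?_, fun v hv => key v hv.symm⟩
  obtain ⟨r, hr, h | h⟩ := Ray.step hp ha.symm
  · have := level_sub_level hp hr h
    omega
  · exact absurd (hr.1.trans (h 1)) (r.ne 0)

lemma range_shift_eq (t : V) : Set.range (fun j => T.shift j t) =
    {s | T.graph.Adj t s ∧ T.level s = T.level t + 1} := by
  rw [T.range_shift t]
  ext s
  simp only [Set.mem_ofPred_eq, SimpleGraph.dist_eq_one_iff_adj, prec_iff_level]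
  constructor
  · rintro ⟨h, ha⟩
    have := level_of_adj ha
    exact ⟨ha, by omega⟩
  · rintro ⟨ha, h⟩
    exact ⟨by omega, ha⟩

lemma level_shift (j : Fin q) (t : V) : T.level (T.shift j t) = T.level t + 1 := by
  have : T.shift j t ∈ Set.range (fun j => T.shift j t) := ⟨j, rfl⟩
  rw [range_shift_eq] at this
  exact this.2

lemma exists_shift_eq (s : V) : ∃ j t, T.shift j t = s := by
  obtain ⟨u, ha, hl, -⟩ := T.exists_parent s
  have : s ∈ Set.range (fun j => T.shift j u) := by
    rw [range_shift_eq]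
    exact ⟨ha.symm, hl⟩
  obtain ⟨j, hj⟩ := this
  exact ⟨j, u, hj⟩

/-- A count: the `q + 1` neighbours of `t` are its parent and the values `tα_j`, so `q` indices have
`q` distinct values. -/
lemma shift_index_injective (t : V) : Function.Injective fun j => T.shift j t := by
  obtain ⟨u, ha, hl, hu⟩ := T.exists_parent t
  have h1 : insert u (Set.range fun j => T.shift j t) = T.graph.neighborSet t := by
    rw [range_shift_eq]
    ext s
    simp only [Set.mem_insert_iff, Set.mem_ofPred_eq, SimpleGraph.mem_neighborSet]
    constructor
    · rintro (rfl | h)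
      exacts [ha, h.1]
    · intro h
      rcases level_of_adj h with h' | h'
      · exact Or.inl (hu s h h')
      · exact Or.inr ⟨h, by omega⟩
  have h2 : u ∉ Set.range fun j => T.shift j t := by
    rw [range_shift_eq]
    rintro ⟨-, h⟩
    omega
  have h3 := T.degree t
  rw [← h1, Set.encard_insert_of_notMem h2] at h3
  have h4 : (Set.range fun j => T.shift j t).encard = q := by
    exact WithTop.add_right_cancel ENat.one_ne_top h3
  rw [← Set.image_univ] at h4
  have h5 : (Set.univ : Set (Fin q)).encard = q := by simp
  rw [← Set.injOn_univ]
  exact Set.finite_univ.injOn_of_encard_image_eq (h4.trans h5.symm)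

/-- The parent of a node is unique, so `s = t`. Together with `exists_shift_eq`, the images of the
shifts partition the nodes; this is what makes `α` unitary. -/
lemma shift_eq_shift_iff {i j : Fin q} {s t : V} : T.shift i s = T.shift j t ↔ i = j ∧ s = t := by
  refine ⟨fun h => ?_, by rintro ⟨rfl, rfl⟩; rfl⟩
  have key : ∀ (j : Fin q) t, T.graph.Adj (T.shift j t) t := by
    intro j t
    have : T.shift j t ∈ Set.range (fun j => T.shift j t) := ⟨j, rfl⟩
    rw [range_shift_eq] at this
    exact this.1.symm
  obtain ⟨u, -, -, hu⟩ := T.exists_parent (T.shift i s)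
  have hs := hu s (key i s) (level_shift i s)
  have ht := hu t (h ▸ key j t) (h ▸ level_shift j t)
  obtain rfl := hs.trans ht.symm
  exact ⟨shift_index_injective s h, rfl⟩

lemma level_act (w : List (Fin q)) (t : V) : T.level (T.act t w) = T.level t + w.length := by
  induction w generalizing t with
  | nil => simp [act]
  | cons j w ih =>
    change T.level (T.act (T.shift j t) w) = _
    rw [ih, level_shift, List.length_cons]
    push_cast
    ring

lemma exists_act_eq (n : ℕ) (s : V) :
    ∃ (w : Fin n → Fin q) (t : V), T.act t (List.ofFn w) = s := by
  suffices ∃ (w : List (Fin q)) (t : V), w.length = n ∧ T.act t w = s by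
    obtain ⟨w, t, rfl, h⟩ := this
    exact ⟨w.get, t, by rwa [List.ofFn_get]⟩
  induction n generalizing s with
  | zero => exact ⟨[], s, rfl, rfl⟩
  | succ n ih =>
    obtain ⟨j, u, rfl⟩ := T.exists_shift_eq s
    obtain ⟨w, t, hw, rfl⟩ := ih u
    exact ⟨w ++ [j], t, by simp [hw], by simp [act]⟩

end ShiftTree

/-! ### The series `∑ aⁿ (a*)ⁿ` in a C*-algebra -/

section GramSeries

variable {A : Type*} [CStarAlgebra A]

/-- The sum of the series `∑ aⁿ (a*)ⁿ`. -/
noncomputable def gramSeries (a : A) : A := ∑' n : ℕ, a ^ n * star a ^ n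

/-- The element `r - r a* r⁻¹ a r`, where `r = ∑ aⁿ (a*)ⁿ`. -/
noncomputable def gramMiddle (a : A) : A :=
  gramSeries a - gramSeries a * star a * Ring.inverse (gramSeries a) * a * gramSeries a

variable {a : A}

lemma summable_gramSeries (ha : Summable fun n => ‖a ^ n‖) :
    Summable fun n : ℕ => a ^ n * star a ^ n := by
  refine Summable.of_norm_bounded_eventually_nat ha ?_
  filter_upwards [ha.tendsto_atTop_zero.eventually_le_const zero_lt_one] with n hn
  calc ‖a ^ n * star a ^ n‖ ≤ ‖a ^ n‖ * ‖star a ^ n‖ := norm_mul_le _ _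
    _ = ‖a ^ n‖ * ‖a ^ n‖ := by rw [← star_pow, norm_star]
    _ ≤ ‖a ^ n‖ := mul_le_of_le_one_right (norm_nonneg _) hn

/-- The Stein equation, obtained by splitting off the term `n = 0`. All later identities for `r`
come from it. -/
lemma gramSeries_eq (ha : Summable fun n => ‖a ^ n‖) :
    gramSeries a = 1 + a * gramSeries a * star a := by
  have hs := summable_gramSeries ha
  unfold gramSeries
  rw [← hs.tsum_mul_left, ← (hs.mul_left a).tsum_mul_right, hs.tsum_eq_zero_add]
  simp only [pow_zero, mul_one]
  congr 2
  funext n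
  rw [pow_succ' a, pow_succ (star a)]
  simp only [mul_assoc]

lemma star_gramSeries : star (gramSeries a) = gramSeries a := by
  rw [gramSeries, tsum_star]
  simp

lemma star_inverse_gramSeries :
    star (Ring.inverse (gramSeries a)) = Ring.inverse (gramSeries a) := by
  rw [← Ring.inverse_star, star_gramSeries]

lemma star_gramMiddle : star (gramMiddle a) = gramMiddle a := by
  simp only [gramMiddle, star_sub, star_mul, star_star, star_gramSeries, star_inverse_gramSeries,
    mul_assoc]

lemma one_sub_mul_tsum_pow (ha : Summable fun n => ‖a ^ n‖) : (1 - a) * ∑' n : ℕ, a ^ n = 1 :=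
  (Summable.of_norm ha).one_sub_mul_tsum_pow

lemma tsum_pow_mul_one_sub (ha : Summable fun n => ‖a ^ n‖) : (∑' n : ℕ, a ^ n) * (1 - a) = 1 :=
  (Summable.of_norm ha).tsum_pow_mul_one_sub

/-- The Stein equation multiplied by `(1 - a)⁻¹`. It isolates `(1 - a)⁻¹` in `B_c*` up to the
strictly causal term `r a*`. -/
lemma tsum_pow_mul_gramSeries (ha : Summable fun n => ‖a ^ n‖) :
    (∑' n : ℕ, a ^ n) * gramSeries a * (1 - star a) =
      (∑' n : ℕ, a ^ n) - gramSeries a * star a := by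
  have h1 := tsum_pow_mul_one_sub ha
  have h2 := gramSeries_eq ha
  set k := ∑' n : ℕ, a ^ n
  set r := gramSeries a
  have h3 : r * (1 - star a) = (1 - a) * (r * (1 - star a)) - (1 - a) * r + 1 := by
    linear_combination (norm := noncomm_ring) h2
  calc k * r * (1 - star a)
      = k * ((1 - a) * (r * (1 - star a)) - (1 - a) * r + 1) := by rw [mul_assoc, ← h3]
    _ = k * (1 - a) * (r * (1 - star a)) - k * (1 - a) * r + k := by noncomm_ring
    _ = k - r * star a := by rw [h1]; noncomm_ring

variable [PartialOrder A] [StarOrderedRing A]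

lemma gramSeries_nonneg : 0 ≤ gramSeries a :=
  tsum_nonneg fun n => by rw [← star_pow]; exact mul_star_self_nonneg _

lemma isUnit_gramSeries (ha : Summable fun n => ‖a ^ n‖) : IsUnit (gramSeries a) := by
  refine CStarAlgebra.isUnit_of_le 1 ?_
  rw [gramSeries_eq ha]
  exact le_add_of_nonneg_right (star_right_conjugate_nonneg gramSeries_nonneg _)

/-- Since `a r a* = r - 1`, the two terms containing `r a*` without a final `r⁻¹` cancel. -/
lemma gramMiddle_mul_star (ha : Summable fun n => ‖a ^ n‖) :
    gramMiddle a * star a = gramSeries a * star a * Ring.inverse (gramSeries a) := by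
  have h1 := Ring.mul_inverse_cancel _ (isUnit_gramSeries ha)
  have h2 := Ring.inverse_mul_cancel _ (isUnit_gramSeries ha)
  have h3 := gramSeries_eq ha
  rw [gramMiddle]
  set r := gramSeries a
  set s := Ring.inverse r
  have h4 : a * r * star a = r - 1 := by rw [eq_sub_iff_add_eq, add_comm]; exact h3.symm
  calc (r - r * star a * s * a * r) * star a
      = r * star a - r * star a * s * (a * r * star a) := by noncomm_ring
    _ = r * star a - r * star a * (s * r) + r * star a * s := by rw [h4]; noncomm_ring
    _ = _ := by rw [h2]; noncomm_ring

lemma mul_gramMiddle (ha : Summable fun n => ‖a ^ n‖) :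
    a * gramMiddle a = Ring.inverse (gramSeries a) * a * gramSeries a := by
  have := congrArg star (gramMiddle_mul_star ha)
  simpa only [star_mul, star_star, star_gramMiddle, star_gramSeries, star_inverse_gramSeries,
    mul_assoc] using this

lemma mul_gramMiddle_mul_star (ha : Summable fun n => ‖a ^ n‖) :
    a * gramMiddle a * star a = 1 - Ring.inverse (gramSeries a) := by
  rw [mul_gramMiddle ha, mul_assoc, mul_assoc, ← mul_assoc a,
    show a * gramSeries a * star a = gramSeries a - 1 by
      rw [eq_sub_iff_add_eq, add_comm]; exact (gramSeries_eq ha).symm,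
    mul_sub, Ring.inverse_mul_cancel _ (isUnit_gramSeries ha), mul_one]

/-- The Woodbury formula `m⁻¹ = r⁻¹ + a*a`, which explains the form of `L_c`. -/
lemma gramMiddle_mul (ha : Summable fun n => ‖a ^ n‖) :
    gramMiddle a * (Ring.inverse (gramSeries a) + star a * a) = 1 := by
  rw [mul_add, ← mul_assoc, gramMiddle_mul_star ha, gramMiddle, sub_mul, mul_assoc _ (gramSeries a),
    Ring.mul_inverse_cancel _ (isUnit_gramSeries ha)]
  noncomm_ring

lemma mul_gramMiddle_cancel (ha : Summable fun n => ‖a ^ n‖) :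
    (Ring.inverse (gramSeries a) + star a * a) * gramMiddle a = 1 := by
  have := congrArg star (gramMiddle_mul ha)
  simpa only [star_mul, star_add, star_star, star_gramMiddle, star_inverse_gramSeries,
    star_one] using this

lemma isUnit_gramMiddle (ha : Summable fun n => ‖a ^ n‖) : IsUnit (gramMiddle a) :=
  ⟨⟨_, _, gramMiddle_mul ha, mul_gramMiddle_cancel ha⟩, rfl⟩

/-- `m = m* m⁻¹ m` is congruent to the positive element `m⁻¹ = r⁻¹ + a*a`. -/
lemma gramMiddle_nonneg (ha : Summable fun n => ‖a ^ n‖) : 0 ≤ gramMiddle a := by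
  have hs : 0 ≤ Ring.inverse (gramSeries a) := by
    have := star_left_conjugate_nonneg (gramSeries_nonneg (a := a)) (Ring.inverse (gramSeries a))
    rwa [star_inverse_gramSeries, Ring.inverse_mul_cancel _ (isUnit_gramSeries ha), one_mul] at this
  have h : gramMiddle a =
      star (gramMiddle a) * (Ring.inverse (gramSeries a) + star a * a) * gramMiddle a := by
    rw [mul_assoc, mul_gramMiddle_cancel ha, mul_one, star_gramMiddle]
  rw [h]
  exact star_left_conjugate_nonneg (add_nonneg hs (star_mul_self_nonneg a)) _

/-- The inverse of `1 - m a*`, where `m = r - r a* r⁻¹ a r`. -/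
noncomputable def blaschkeResolvent (a : A) : A :=
  gramSeries a * star (∑' n : ℕ, a ^ n) * Ring.inverse (gramSeries a)

/-- By `gramMiddle_mul_star`, `1 - m a* = r (1 - a*) r⁻¹` is similar to `1 - a*`, which is
invertible by the Neumann series. -/
lemma one_sub_mul_blaschkeResolvent (ha : Summable fun n => ‖a ^ n‖) :
    (1 - gramMiddle a * star a) * blaschkeResolvent a = 1 := by
  have h1 := Ring.mul_inverse_cancel _ (isUnit_gramSeries ha)
  have h2 := Ring.inverse_mul_cancel _ (isUnit_gramSeries ha)
  have h3 := congrArg star (tsum_pow_mul_one_sub ha)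
  rw [star_mul, star_sub, star_one] at h3
  rw [gramMiddle_mul_star ha, blaschkeResolvent]
  set r := gramSeries a
  set s := Ring.inverse r
  set k := star (∑' n : ℕ, a ^ n)
  calc (1 - r * star a * s) * (r * k * s) = r * k * s - r * star a * (s * r) * k * s := by
        noncomm_ring
    _ = r * ((1 - star a) * k) * s := by rw [h2]; noncomm_ring
    _ = 1 := by rw [h3, mul_one, h1]

lemma blaschkeResolvent_mul (ha : Summable fun n => ‖a ^ n‖) :
    blaschkeResolvent a * (1 - gramMiddle a * star a) = 1 := by
  have h1 := Ring.mul_inverse_cancel _ (isUnit_gramSeries ha)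
  have h2 := Ring.inverse_mul_cancel _ (isUnit_gramSeries ha)
  have h3 := congrArg star (one_sub_mul_tsum_pow ha)
  rw [star_mul, star_sub, star_one] at h3
  rw [gramMiddle_mul_star ha, blaschkeResolvent]
  set r := gramSeries a
  set s := Ring.inverse r
  set k := star (∑' n : ℕ, a ^ n)
  calc (r * k * s) * (1 - r * star a * s) = r * k * s - r * k * (s * r) * star a * s := by
        noncomm_ring
    _ = r * (k * (1 - star a)) * s := by rw [h2]; noncomm_ring
    _ = 1 := by rw [h3, mul_one, h1]

lemma blaschke_identity (ha : Summable fun n => ‖a ^ n‖) :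
    (1 - a) * blaschkeResolvent a * gramMiddle a * star (blaschkeResolvent a) * (1 - star a) =
      1 := by
  have h1 := blaschkeResolvent_mul ha
  have h2 := congrArg star (one_sub_mul_blaschkeResolvent ha)
  rw [star_mul, star_sub, star_mul, star_star, star_one, star_gramMiddle] at h2
  -- The crucial cancellation: the middle factor is `m⁻¹`, and `a m a* = 1 - r⁻¹` removes the
  -- remaining `r⁻¹`.
  have h4 : (1 - a * gramMiddle a) * (Ring.inverse (gramSeries a) + star a * a) *
      (1 - gramMiddle a * star a) = (1 - star a) * (1 - a) := by
    have e := mul_gramMiddle_mul_star ha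
    have e1 := gramMiddle_mul ha
    have e2 := mul_gramMiddle_cancel ha
    set m := gramMiddle a
    set w := Ring.inverse (gramSeries a) + star a * a with hw
    calc (1 - a * m) * w * (1 - m * star a)
        = w - (w * m) * star a - a * (m * w) + a * (m * w) * m * star a := by noncomm_ring
      _ = w - star a - a + a * m * star a := by rw [e1, e2]; noncomm_ring
      _ = _ := by rw [e, hw]; noncomm_ring
  have k1 := one_sub_mul_tsum_pow ha
  have k2 := tsum_pow_mul_one_sub ha
  have k3 := congrArg star k1
  have k4 := congrArg star k2
  rw [star_mul, star_sub, star_one] at k3 k4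
  have e1 := gramMiddle_mul ha
  set m := gramMiddle a
  set w := Ring.inverse (gramSeries a) + star a * a
  set k := ∑' n : ℕ, a ^ n
  set z := blaschkeResolvent a
  -- Inverting `h4` gives `z m z* = k k*` with `k = (1 - a)⁻¹`.
  have e3 : z * m * star z = k * star k := by
    calc z * m * star z = z * m * star z * ((1 - star a) * ((1 - a) * k) * star k) := by
          rw [k1, mul_one, k4, mul_one]
      _ = z * m * star z * ((1 - star a) * (1 - a)) * (k * star k) := by noncomm_ring
      _ = z * m * (star z * (1 - a * m)) * w * (1 - m * star a) * (k * star k) := by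
          rw [← h4]; noncomm_ring
      _ = z * (m * w) * (1 - m * star a) * (k * star k) := by rw [h2]; noncomm_ring
      _ = z * (1 - m * star a) * (k * star k) := by rw [e1, mul_one]
      _ = _ := by rw [h1, one_mul]
  calc (1 - a) * z * m * star z * (1 - star a) = (1 - a) * (z * m * star z) * (1 - star a) := by
        noncomm_ring
    _ = ((1 - a) * k) * (star k * (1 - star a)) := by rw [e3]; noncomm_ring
    _ = 1 := by rw [k1, k3, one_mul]

end GramSeries

open ContinuousLinearMap (adjoint)

/-! ### Positive square roots -/

section SquareRoot

variable {H : Type*} [NormedAddCommGroup H] [InnerProductSpace ℂ H] [CompleteSpace H]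
  {S S' : H →L[ℂ] H}

lemma opSqrt_nonneg : 0 ≤ opSqrt S := CFC.sqrt_nonneg S

lemma adjoint_opSqrt : adjoint (opSqrt S) = opSqrt S :=
  (CFC.sqrt_nonneg S).isSelfAdjoint

lemma opSqrt_mul_self (hS : 0 ≤ S) : opSqrt S * opSqrt S = S := CFC.sqrt_mul_sqrt_self S hS

lemma opSqrt_eq (h : S' * S' = S) (hS : 0 ≤ S') : opSqrt S = S' := CFC.sqrt_unique h hS

lemma isUnit_opSqrt (hS : 0 ≤ S) (h : IsUnit S) : IsUnit (opSqrt S) :=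
  (CFC.isUnit_sqrt_iff S hS).2 h

lemma commute_opSqrt (h : Commute S S') : Commute (opSqrt S) S' :=
  Commute.cfcₙ_nnreal h _

end SquareRoot

/-! ### Basis vectors, columns and rows -/

section Operators

variable {V : Type*} {q : ℕ}

lemma inner_chi (t : V) (f : L2 V) : inner ℂ (chi t) f = f t := by
  classical
  unfold chi
  rw [lp.inner_single_left]
  simp

lemma chi_apply_self (t : V) : chi t t = 1 := by
  classical
  unfold chi
  exact lp.single_apply_self _ _ _

lemma chi_apply_ne {s t : V} (h : s ≠ t) : chi t s = 0 := by
  classical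
  unfold chi
  rw [lp.single_apply_ne _ _ _ h]

lemma colOp_apply (G : Fin q → Op V) (f : L2 V) (j : Fin q) : colOp G f j = G j f := rfl

lemma rowOp_apply (c : Fin q → Op V) (g : L2q V q) : rowOp c g = ∑ j, c j (g j) := by
  simp [rowOp]

lemma adjoint_colOp (G : Fin q → Op V) : adjoint (colOp G) = rowOp fun j => adjoint (G j) := by
  symm
  rw [ContinuousLinearMap.eq_adjoint_iff]
  intro g f
  rw [rowOp_apply, sum_inner, PiLp.inner_apply]
  refine Finset.sum_congr rfl fun j _ => ?_
  rw [ContinuousLinearMap.adjoint_inner_left, colOp_apply]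

lemma norm_compOp_le (a : V → V) (ha : Function.Injective a) : ‖compOp a ha‖ ≤ 1 :=
  LinearMap.mkContinuous_norm_le _ zero_le_one _

end Operators

/-! ### The unitary column `α` and the unitarity of the Blaschke factor -/

namespace ShiftTree

variable {V : Type*} {q : ℕ} {T : ShiftTree V q}

lemma alpha_apply (j : Fin q) (f : L2 V) (t : V) : T.alpha j f t = f (T.shift j t) := rfl

lemma adjoint_alpha_apply_shift (i j : Fin q) (f : L2 V) (t : V) :
    adjoint (T.alpha j) f (T.shift i t) = if i = j then f t else 0 := by
  rw [← inner_chi, ContinuousLinearMap.adjoint_inner_right]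
  split_ifs with h
  · subst h
    rw [← inner_chi]
    congr 1
    ext s
    rw [alpha_apply]
    by_cases hs : s = t
    · subst hs
      rw [chi_apply_self, chi_apply_self]
    · rw [chi_apply_ne hs, chi_apply_ne]
      exact fun e => hs (shift_eq_shift_iff.1 e).2
  · have : T.alpha j (chi (T.shift i t)) = 0 := by
      ext s
      rw [alpha_apply, chi_apply_ne fun e => h (shift_eq_shift_iff.1 e).1.symm]
      rfl
    rw [this, inner_zero_left]

lemma adjoint_alphaCol_apply_shift (g : L2q V q) (i : Fin q) (t : V) :
    adjoint T.alphaCol g (T.shift i t) = g i t := by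
  rw [alphaCol, adjoint_colOp, rowOp_apply, lp.coeFn_sum, Finset.sum_apply]
  simp [adjoint_alpha_apply_shift]

/-- The shifts are injective with disjoint images. The opposite relation below uses that these
images cover all nodes. -/
lemma alphaCol_comp_adjoint :
    T.alphaCol ∘L adjoint T.alphaCol = ContinuousLinearMap.id ℂ (L2q V q) := by
  ext g i t
  exact adjoint_alphaCol_apply_shift g i t

lemma adjoint_comp_alphaCol : adjoint T.alphaCol ∘L T.alphaCol = 1 := by
  ext f s
  obtain ⟨i, t, rfl⟩ := T.exists_shift_eq s
  exact adjoint_alphaCol_apply_shift _ i t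

lemma alphaCol_adjoint_apply (g : L2q V q) : T.alphaCol (adjoint T.alphaCol g) = g :=
  DFunLike.congr_fun alphaCol_comp_adjoint g

lemma adjoint_alphaCol_apply (f : L2 V) : adjoint T.alphaCol (T.alphaCol f) = f :=
  DFunLike.congr_fun adjoint_comp_alphaCol f

/-- Conjugation by the unitary column `α`. -/
noncomputable def conj (T : ShiftTree V q) (S : Op V) : L2q V q →L[ℂ] L2q V q :=
  T.alphaCol ∘L S ∘L adjoint T.alphaCol

lemma conj_mul (S S' : Op V) : T.conj S * T.conj S' = T.conj (S * S') := by
  ext1 g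
  simp [conj, adjoint_alphaCol_apply]

lemma conj_one : T.conj 1 = 1 := alphaCol_comp_adjoint

lemma conj_sub (S S' : Op V) : T.conj (S - S') = T.conj S - T.conj S' := by
  ext1 g
  simp [conj]

lemma inverse_conj {S S' : Op V} (h : S * S' = 1) (h' : S' * S = 1) :
    Ring.inverse (T.conj S) = T.conj S' := by
  have hu : T.conj S = ((⟨T.conj S, T.conj S', by rw [conj_mul, h, conj_one],
    by rw [conj_mul, h', conj_one]⟩ : (L2q V q →L[ℂ] L2q V q)ˣ) : L2q V q →L[ℂ] L2q V q) := rfl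
  rw [hu, Ring.inverse_unit]
  rfl

lemma conj_nonneg {S : Op V} (hS : 0 ≤ S) : 0 ≤ T.conj S := by
  rw [ContinuousLinearMap.nonneg_iff_isPositive] at hS ⊢
  exact hS.conj_adjoint T.alphaCol

lemma sqrt_conj {S : Op V} (hS : 0 ≤ S) : opSqrt (T.conj S) = T.conj (opSqrt S) := by
  refine opSqrt_eq ?_ (conj_nonneg opSqrt_nonneg)
  rw [conj_mul, opSqrt_mul_self hS]

variable (T)

lemma summable_norm_cAlpha_pow {c : Fin q → Op V} (hc : c ∈ T.ball) :
    Summable fun n => ‖T.cAlpha c ^ n‖ := by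
  obtain ⟨-, ρ, hρ, h⟩ := hc
  -- Root test; the maximum with `0` makes the ratio `r` nonnegative.
  obtain ⟨r, hr, hr1⟩ := exists_between (max_lt hρ zero_lt_one)
  have hr0 : 0 ≤ r := (le_max_right _ _).trans hr.le
  refine Summable.of_norm_bounded_eventually_nat (summable_geometric_of_lt_one hr0 hr1) ?_
  filter_upwards [h.eventually_lt_const ((le_max_left _ _).trans_lt hr), eventually_gt_atTop 0]
    with n hn hn0
  rw [norm_norm]
  have h1 : (‖T.cAlpha c ^ n‖ ^ (1 / (n : ℝ))) ^ n = ‖T.cAlpha c ^ n‖ := by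
    rw [one_div, Real.rpow_inv_natCast_pow (norm_nonneg _) hn0.ne']
  rw [← h1]
  exact pow_le_pow_left₀ (by positivity) hn.le n

lemma rowOp_eq (c : Fin q → Op V) : rowOp c = T.cAlpha c ∘L adjoint T.alphaCol := by
  ext1 g
  simp [cAlpha, alphaCol_adjoint_apply]

lemma adjoint_rowOp (c : Fin q → Op V) :
    adjoint (rowOp c) = T.alphaCol ∘L star (T.cAlpha c) := by
  rw [rowOp_eq T c, ContinuousLinearMap.adjoint_comp, ContinuousLinearMap.adjoint_adjoint]
  rfl

lemma adjoint_alphaCol_comp_adjoint_rowOp (c : Fin q → Op V) :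
    adjoint T.alphaCol ∘L adjoint (rowOp c) = star (T.cAlpha c) := by
  rw [adjoint_rowOp T, ← ContinuousLinearMap.comp_assoc, adjoint_comp_alphaCol]
  rfl

lemma R_eq (c : Fin q → Op V) : T.R c = gramSeries (T.cAlpha c) := by
  rw [R, adjoint_alphaCol_comp_adjoint_rowOp]
  rfl

lemma L_eq (c : Fin q → Op V) : T.L c = T.conj (gramMiddle (T.cAlpha c)) := by
  rw [L, adjoint_alphaCol_comp_adjoint_rowOp, R_eq]
  rfl

variable {T}

/-- Inverses and square roots commute with conjugation by the unitary `α`, so `B_c` reduces to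
operators on `ℓ₂` followed on the right by `α*`. -/
lemma blaschke_eq {c : Fin q → Op V} (hc : c ∈ T.ball) :
    T.blaschke c = (1 - T.cAlpha c) ∘L blaschkeResolvent (T.cAlpha c) ∘L
      opSqrt (gramMiddle (T.cAlpha c)) ∘L adjoint T.alphaCol := by
  have ha := T.summable_norm_cAlpha_pow hc
  have h1 : 1 - T.L c ∘L adjoint (rowOp c) ∘L adjoint T.alphaCol =
      T.conj (1 - gramMiddle (T.cAlpha c) * star (T.cAlpha c)) := by
    rw [L_eq, adjoint_rowOp T, conj_sub, conj_one, ← conj_mul]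
    rfl
  rw [blaschke, h1,
    inverse_conj (one_sub_mul_blaschkeResolvent ha) (blaschkeResolvent_mul ha), L_eq,
    sqrt_conj (gramMiddle_nonneg ha), rowOp_eq T c]
  ext1 g
  simp [conj, adjoint_alphaCol_apply]

lemma adjoint_blaschke {c : Fin q → Op V} (hc : c ∈ T.ball) :
    adjoint (T.blaschke c) = T.alphaCol ∘L (opSqrt (gramMiddle (T.cAlpha c)) *
      star (blaschkeResolvent (T.cAlpha c)) * (1 - star (T.cAlpha c))) := by
  have h' : adjoint (1 - T.cAlpha c) = 1 - star (T.cAlpha c) := by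
    change star (1 - T.cAlpha c) = _
    rw [star_sub, star_one]
  rw [blaschke_eq hc, ContinuousLinearMap.adjoint_comp, ContinuousLinearMap.adjoint_comp,
    ContinuousLinearMap.adjoint_comp, ContinuousLinearMap.adjoint_adjoint, adjoint_opSqrt, h']
  rfl

lemma blaschke_comp_adjoint {c : Fin q → Op V} (hc : c ∈ T.ball) :
    T.blaschke c ∘L adjoint (T.blaschke c) = ContinuousLinearMap.id ℂ (L2 V) := by
  have ha := T.summable_norm_cAlpha_pow hc
  have key := blaschke_identity ha
  rw [← opSqrt_mul_self (gramMiddle_nonneg ha)] at key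
  rw [adjoint_blaschke hc, blaschke_eq hc]
  refine Eq.trans ?_ key
  ext1 f
  simp [adjoint_alphaCol_apply]

lemma adjoint_comp_blaschke {c : Fin q → Op V} (hc : c ∈ T.ball) :
    adjoint (T.blaschke c) ∘L T.blaschke c = ContinuousLinearMap.id ℂ (L2q V q) := by
  have ha := T.summable_norm_cAlpha_pow hc
  have k1 := tsum_pow_mul_one_sub ha
  have k2 := one_sub_mul_blaschkeResolvent ha
  have k3 : Ring.inverse (opSqrt (gramMiddle (T.cAlpha c))) *
      opSqrt (gramMiddle (T.cAlpha c)) = 1 :=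
    Ring.inverse_mul_cancel _ (isUnit_opSqrt (gramMiddle_nonneg ha) (isUnit_gramMiddle ha))
  set A := T.cAlpha c
  set N := opSqrt (gramMiddle A)
  -- All factors of `B_c` are invertible, which gives an explicit left inverse; as `B_c*` is a right
  -- inverse, the two coincide.
  have hX : (T.alphaCol ∘L (Ring.inverse N * (1 - gramMiddle A * star A) * ∑' n : ℕ, A ^ n)) ∘L
      T.blaschke c = ContinuousLinearMap.id ℂ (L2q V q) := by
    have h : (Ring.inverse N * (1 - gramMiddle A * star A) * ∑' n : ℕ, A ^ n) *
        ((1 - A) * blaschkeResolvent A * N) = 1 := by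
      calc _ = Ring.inverse N * ((1 - gramMiddle A * star A) * (((∑' n : ℕ, A ^ n) * (1 - A)) *
            blaschkeResolvent A)) * N := by simp only [mul_assoc]
        _ = 1 := by rw [k1, one_mul, k2, mul_one, k3]
    rw [blaschke_eq hc]
    exact (congrArg T.conj h).trans conj_one
  have h2 := blaschke_comp_adjoint hc
  have : adjoint (T.blaschke c) =
      T.alphaCol ∘L (Ring.inverse N * (1 - gramMiddle A * star A) * ∑' n : ℕ, A ^ n) := by
    rw [← ContinuousLinearMap.id_comp (adjoint (T.blaschke c)), ← hX,
      ContinuousLinearMap.comp_assoc, h2, ContinuousLinearMap.comp_id]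
  rw [this, hX]

end ShiftTree

/-! ### Matrix entries of bounded operators -/

section Operators

variable {V : Type*}

lemma adjoint_restrictOp (A : Set V) : adjoint (restrictOp A) = restrictOp A := by
  classical
  symm
  rw [ContinuousLinearMap.eq_adjoint_iff]
  intro f g
  rw [lp.inner_eq_tsum, lp.inner_eq_tsum]
  refine tsum_congr fun t => ?_
  rw [restrictOp_apply, restrictOp_apply, Set.indicator_apply, Set.indicator_apply]
  split_ifs <;> simp

lemma hasSum_apply_apply {ι : Type*} {S : ι → Op V} {S' : Op V} (h : HasSum S S') (f : L2 V)
    (t : V) : HasSum (fun i => S i f t) (S' f t) := by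
  have := (h.mapL (ContinuousLinearMap.apply ℂ (L2 V) f)).mapL (innerSL ℂ (chi t))
  simpa [inner_chi] using this

lemma hasSum_apply_chi (S : Op V) (f : L2 V) (s : V) :
    HasSum (fun t => f t * S (chi t) s) (S f s) := by
  classical
  have hf : HasSum (fun t => f t • chi t) f := by
    convert lp.hasSum_single (p := 2) (by norm_num) f with t
    unfold chi
    rw [← lp.single_smul, smul_eq_mul, mul_one]
  have := (S.hasSum hf).mapL (innerSL ℂ (chi s))
  simpa [inner_chi] using this

lemma ext_chi {S S' : Op V} (h : ∀ t, S (chi t) = S' (chi t)) : S = S' := by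
  ext f s
  have h1 := hasSum_apply_chi S f s
  simp only [h] at h1
  exact h1.unique (hasSum_apply_chi S' f s)

end Operators

/-! ### Operators graded by level, and causality -/

namespace ShiftTree

variable {V : Type*} {q : ℕ} {T : ShiftTree V q}

/-- If `f` vanishes at all nodes up to the level `k`, then `S f` vanishes at all nodes up to the
level `k + m`. -/
def RaisesLevel (T : ShiftTree V q) (m : ℤ) (S : Op V) : Prop :=
  ∀ (k : ℤ) (f : L2 V), (∀ t, T.level t ≤ k → f t = 0) → ∀ t, T.level t ≤ k + m → S f t = 0

/-- If `f` vanishes at all nodes of the level `k`, then `S f` vanishes at all nodes of the level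
`k + m`. -/
def ShiftsLevel (T : ShiftTree V q) (m : ℤ) (S : Op V) : Prop :=
  ∀ (k : ℤ) (f : L2 V), (∀ t, T.level t = k → f t = 0) → ∀ t, T.level t = k + m → S f t = 0

/-- The projection onto the functions that are supported by the nodes up to the level `k`. -/
noncomputable def below (T : ShiftTree V q) (k : ℤ) : Op V := restrictOp {t | T.level t ≤ k}

lemma below_apply_of_le {k : ℤ} {t : V} (h : T.level t ≤ k) (f : L2 V) : T.below k f t = f t :=
  Set.indicator_of_mem (s := {t | T.level t ≤ k}) h _

lemma below_apply_of_lt {k : ℤ} {t : V} (h : k < T.level t) (f : L2 V) : T.below k f t = 0 :=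
  Set.indicator_of_notMem (s := {t | T.level t ≤ k}) h.not_ge _

lemma isCausal_iff {S : Op V} : T.IsCausal S ↔ T.RaisesLevel 0 S := by
  simp only [IsCausal, RaisesLevel, prec_iff_level, add_zero]
  exact ⟨fun h k f hf t ht => h t f (fun s hs => hf s (hs.trans ht)) t le_rfl,
    fun h s f hf => h (T.level s) f hf⟩

lemma raisesLevel_iff_chi {m : ℤ} {S : Op V} :
    T.RaisesLevel m S ↔ ∀ s t, T.level s < T.level t + m → S (chi t) s = 0 := by
  constructor
  · intro h s t hst
    -- `χ_t` vanishes at all nodes up to the level just before that of `t`.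
    refine h (T.level t - 1) _ (fun x hx => chi_apply_ne ?_) s (by omega)
    rintro rfl
    omega
  · intro h k f hf s hs
    refine (hasSum_apply_chi S f s).unique ?_
    convert hasSum_zero with t
    by_cases ht : T.level t ≤ k
    · rw [hf t ht, zero_mul]
    · rw [h s t (by omega), mul_zero]

namespace RaisesLevel

variable {m n : ℤ} {S S' : Op V}

lemma mul (h : T.RaisesLevel m S) (h' : T.RaisesLevel n S') : T.RaisesLevel (m + n) (S * S') :=
  fun k f hf t ht => h (k + n) _ (h' k f hf) t (by omega)

lemma add (h : T.RaisesLevel m S) (h' : T.RaisesLevel m S') : T.RaisesLevel m (S + S') :=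
  fun k f hf t ht => by
    have : (S + S') f t = S f t + S' f t := rfl
    rw [this, h k f hf t ht, h' k f hf t ht, add_zero]

lemma sub (h : T.RaisesLevel m S) (h' : T.RaisesLevel m S') : T.RaisesLevel m (S - S') :=
  fun k f hf t ht => by
    have : (S - S') f t = S f t - S' f t := rfl
    rw [this, h k f hf t ht, h' k f hf t ht, sub_zero]

lemma one : T.RaisesLevel 0 1 := fun k f hf t ht => hf t (by omega)

lemma pow (h : T.RaisesLevel m S) (N : ℕ) : T.RaisesLevel (N * m) (S ^ N) := by
  induction N with
  | zero => simpa using one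
  | succ N ih =>
    rw [pow_succ]
    convert ih.mul h using 1
    push_cast
    ring

lemma hasSum {ι : Type*} {S : ι → Op V} {S' : Op V} (h : HasSum S S')
    (hS : ∀ i, T.RaisesLevel m (S i)) : T.RaisesLevel m S' := fun k f hf t ht => by
  refine (hasSum_apply_apply h f t).unique ?_
  convert hasSum_zero with i
  exact hS i k f hf t ht

lemma sum {ι : Type*} (s : Finset ι) {S : ι → Op V} (hS : ∀ i, T.RaisesLevel m (S i)) :
    T.RaisesLevel m (∑ i ∈ s, S i) := by
  induction s using Finset.cons_induction with
  | empty => exact fun k f hf t ht => rfl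
  | cons i s hi ih =>
    rw [Finset.sum_cons]
    exact (hS i).add ih

lemma below_mul (h : T.RaisesLevel 0 S) (k : ℤ) : T.below k * S = T.below k * S * T.below k := by
  ext f t
  change T.below k (S f) t = T.below k (S (T.below k f)) t
  rcases le_or_gt (T.level t) k with ht | ht
  · rw [below_apply_of_le ht, below_apply_of_le ht, ← sub_eq_zero]
    have : S f t - S (T.below k f) t = S (f - T.below k f) t := by
      rw [map_sub]
      rfl
    rw [this]
    refine h k _ (fun s hs => ?_) t (by omega)
    change f s - T.below k f s = 0
    rw [below_apply_of_le hs, sub_self]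
  · rw [below_apply_of_lt ht, below_apply_of_lt ht]

/-- Causality of `S` means `P S = P S P` for the truncations `P`; causality of `S*` gives `S P = P S
P`. -/
lemma commute_below (h : T.RaisesLevel 0 S) (h' : T.RaisesLevel 0 (star S)) (k : ℤ) :
    Commute S (T.below k) := by
  have h1 := h.below_mul k
  have h2 := congrArg star (h'.below_mul k)
  have h3 : star (T.below k) = T.below k := adjoint_restrictOp _
  simp only [star_mul, star_star, h3] at h2
  rw [Commute, SemiconjBy, h2, h1, mul_assoc]

/-- Commutation with all truncations passes to inverses and square roots, where causality alone
would not be evident. -/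
lemma of_commute_below (h : ∀ k, Commute S (T.below k)) : T.RaisesLevel 0 S := by
  intro k f hf t ht
  rw [add_zero] at ht
  have h0 : T.below k f = 0 := by
    ext s
    rcases le_or_gt (T.level s) k with hs | hs
    · rw [below_apply_of_le hs, hf s hs]
      rfl
    · rw [below_apply_of_lt hs]
      rfl
  rw [← below_apply_of_le ht (S f)]
  have := DFunLike.congr_fun (h k).eq f
  change S (T.below k f) = T.below k (S f) at this
  rw [← this, h0, map_zero]
  rfl

end RaisesLevel

namespace ShiftsLevel

variable {m n : ℤ} {S S' : Op V}

lemma mul (h : T.ShiftsLevel m S) (h' : T.ShiftsLevel n S') : T.ShiftsLevel (m + n) (S * S') :=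
  fun k f hf t ht => h (k + n) _ (h' k f hf) t (by omega)

lemma add (h : T.ShiftsLevel m S) (h' : T.ShiftsLevel m S') : T.ShiftsLevel m (S + S') :=
  fun k f hf t ht => by
    have : (S + S') f t = S f t + S' f t := rfl
    rw [this, h k f hf t ht, h' k f hf t ht, add_zero]

lemma pow (h : T.ShiftsLevel m S) (N : ℕ) : T.ShiftsLevel (N * m) (S ^ N) := by
  induction N with
  | zero => exact fun k f hf t ht => hf t (by simpa using ht)
  | succ N ih =>
    rw [pow_succ]
    convert ih.mul h using 1
    push_cast
    ring

lemma sum {ι : Type*} (s : Finset ι) {S : ι → Op V} (hS : ∀ i, T.ShiftsLevel m (S i)) :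
    T.ShiftsLevel m (∑ i ∈ s, S i) := by
  induction s using Finset.cons_induction with
  | empty => exact fun k f hf t ht => rfl
  | cons i s hi ih =>
    rw [Finset.sum_cons]
    exact (hS i).add ih

/-- If `f` vanishes on the level `k`, its truncations at `k` and `k - 1` agree, and a constant
commutes with both. -/
lemma of_isConst (h : T.IsConst S) : T.ShiftsLevel 0 S := by
  have h0 := isCausal_iff.1 h.1
  have hc := h0.commute_below (isCausal_iff.1 h.2)
  intro k f hf t ht
  rw [add_zero] at ht
  have e : T.below k f = T.below (k - 1) f := by
    ext s
    rcases lt_trichotomy (T.level s) k with hs | hs | hs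
    · rw [below_apply_of_le hs.le, below_apply_of_le (by omega)]
    · rw [below_apply_of_le hs.le, below_apply_of_lt (by omega), hf s hs]
    · rw [below_apply_of_lt hs, below_apply_of_lt (by omega)]
  have e1 := DFunLike.congr_fun (hc k).eq f
  have e2 := DFunLike.congr_fun (hc (k - 1)).eq f
  change S (T.below k f) = T.below k (S f) at e1
  change S (T.below (k - 1) f) = T.below (k - 1) (S f) at e2
  rw [← below_apply_of_le ht.le (S f), ← e1, e, e2, below_apply_of_lt (by omega)]

end ShiftsLevel

lemma raisesLevel_alpha (j : Fin q) : T.RaisesLevel (-1) (T.alpha j) := by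
  intro k f hf t ht
  exact hf _ (by rw [level_shift]; omega)

lemma shiftsLevel_alpha (j : Fin q) : T.ShiftsLevel (-1) (T.alpha j) := by
  intro k f hf t ht
  exact hf _ (by rw [level_shift]; omega)

lemma raisesLevel_star_alpha (j : Fin q) : T.RaisesLevel 1 (star (T.alpha j)) := by
  intro k f hf s hs
  obtain ⟨i, t, rfl⟩ := T.exists_shift_eq s
  refine (adjoint_alpha_apply_shift i j f t).trans ?_
  rw [level_shift] at hs
  rw [hf t (by omega), ite_self]

/-- Each node is some `tα_j`, one level above `t`, so reading `S f` at `tα_j` is reading `α_j S f`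
at `t`. -/
lemma raisesLevel_one_iff {S : Op V} :
    T.RaisesLevel 1 S ↔ ∀ j, T.RaisesLevel 0 (T.alpha j * S) := by
  constructor
  · intro h j
    exact (raisesLevel_alpha j).mul h
  · intro h k f hf s hs
    obtain ⟨i, t, rfl⟩ := T.exists_shift_eq s
    rw [level_shift] at hs
    exact h i k f hf t (by omega)

lemma cAlpha_eq (c : Fin q → Op V) : T.cAlpha c = ∑ j, c j * T.alpha j := by
  ext1 f
  rw [_root_.sum_apply]
  exact rowOp_apply c (T.alphaCol f)

/-! ### Causality of the operators built from `c` -/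

section Ball

variable {c : Fin q → Op V}

lemma raisesLevel_cAlpha (hc : c ∈ T.ball) : T.RaisesLevel (-1) (T.cAlpha c) := by
  rw [cAlpha_eq]
  exact RaisesLevel.sum _ fun j => (isCausal_iff.1 (hc.1 j).1).mul (raisesLevel_alpha j)

lemma shiftsLevel_cAlpha (hc : c ∈ T.ball) : T.ShiftsLevel (-1) (T.cAlpha c) := by
  rw [cAlpha_eq]
  exact ShiftsLevel.sum _ fun j => (ShiftsLevel.of_isConst (hc.1 j)).mul (shiftsLevel_alpha j)

lemma raisesLevel_star_cAlpha (hc : c ∈ T.ball) : T.RaisesLevel 1 (star (T.cAlpha c)) := by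
  rw [cAlpha_eq, star_sum]
  simp only [star_mul]
  exact RaisesLevel.sum _ fun j => (raisesLevel_star_alpha j).mul (isCausal_iff.1 (hc.1 j).2)

lemma raisesLevel_gramSeries (hc : c ∈ T.ball) :
    T.RaisesLevel 0 (gramSeries (T.cAlpha c)) := by
  refine RaisesLevel.hasSum (summable_gramSeries (T.summable_norm_cAlpha_pow hc)).hasSum fun n => ?_
  convert ((raisesLevel_cAlpha hc).pow n).mul ((raisesLevel_star_cAlpha hc).pow n) using 1
  ring

lemma raisesLevel_inverse {S : Op V} (h : T.RaisesLevel 0 S) (h' : T.RaisesLevel 0 (star S)) :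
    T.RaisesLevel 0 (Ring.inverse S) :=
  RaisesLevel.of_commute_below fun k => by
    by_cases hS : IsUnit S
    · obtain ⟨u, rfl⟩ := hS
      rw [Ring.inverse_unit]
      exact (h.commute_below h' k).units_inv_left
    -- The default value of the inverse is `0`, which commutes with everything.
    · rw [Ring.inverse_non_unit _ hS]
      exact Commute.zero_left _

lemma raisesLevel_inverse_gramSeries (hc : c ∈ T.ball) :
    T.RaisesLevel 0 (Ring.inverse (gramSeries (T.cAlpha c))) :=
  raisesLevel_inverse (raisesLevel_gramSeries hc)
    (by rw [star_gramSeries]; exact raisesLevel_gramSeries hc)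

lemma raisesLevel_gramMiddle (hc : c ∈ T.ball) :
    T.RaisesLevel 0 (gramMiddle (T.cAlpha c)) := by
  refine (raisesLevel_gramSeries hc).sub ?_
  exact ((((raisesLevel_gramSeries hc).mul (raisesLevel_star_cAlpha hc)).mul
    (raisesLevel_inverse_gramSeries hc)).mul (raisesLevel_cAlpha hc)).mul
    (raisesLevel_gramSeries hc)

lemma raisesLevel_opSqrt {S : Op V} (h : T.RaisesLevel 0 S) (h' : T.RaisesLevel 0 (star S)) :
    T.RaisesLevel 0 (opSqrt S) :=
  RaisesLevel.of_commute_below fun k => commute_opSqrt (h.commute_below h' k)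

end Ball

/-! ### The diagonals of an operator -/

/-- The operator `∑_{|w| = n} w* S_[w]`; its matrix entry at `(s, t)` is that of `S` if the level
of `s` is that of `t` plus `n`, and `0` otherwise. -/
noncomputable def diagonal (T : ShiftTree V q) (S : Op V) (n : ℕ) : Op V :=
  ∑ w : Fin n → Fin q, adjoint (T.word (List.ofFn w)) * T.coeff S (List.ofFn w)

/-- Distinct words of the same length have disjoint images on the nodes, and `w*` transports `f`
from `t` to `tw`. -/
lemma adjoint_word_apply_act (w w' : List (Fin q)) (h : w.length = w'.length) (f : L2 V) (t : V) :
    adjoint (T.word w) f (T.act t w') = if w = w' then f t else 0 := by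
  induction w generalizing w' t f with
  | nil =>
    obtain rfl := List.length_eq_zero_iff.1 h.symm
    simp only [if_true]
    change adjoint (ContinuousLinearMap.id ℂ (L2 V)) f t = f t
    rw [ContinuousLinearMap.adjoint_id]
    rfl
  | cons j w ih =>
    cases w' with
    | nil => simp at h
    | cons i w' =>
      have e : T.word (j :: w) = T.alpha j ∘L T.word w := by
        unfold word
        rw [List.map_cons, List.prod_cons]
        rfl
      rw [e, ContinuousLinearMap.adjoint_comp]
      change adjoint (T.word w) (adjoint (T.alpha j) f) (T.act (T.shift i t) w') = _
      rw [ih w' (by simpa using h), adjoint_alpha_apply_shift]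
      have hc : j :: w = i :: w' ↔ i = j ∧ w = w' := by
        rw [List.cons.injEq, eq_comm]
      by_cases hw : w = w'
      · by_cases hj : i = j
        · rw [if_pos hw, if_pos hj, if_pos (hc.2 ⟨hj, hw⟩)]
        · rw [if_pos hw, if_neg hj, if_neg fun h => hj (hc.1 h).1]
      · rw [if_neg hw, if_neg fun h => hw (hc.1 h).2]

/-- Write `s = tw` with `|w| = n`; only the term of this word contributes at `s`. -/
lemma diagonal_apply (S : Op V) (n : ℕ) (f : L2 V) (s : V) :
    T.diagonal S n f s = S (restrictOp {x | T.level x = T.level s - n} f) s := by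
  obtain ⟨w, t, rfl⟩ := T.exists_act_eq n s
  rw [diagonal, _root_.sum_apply, lp.coeFn_sum, Finset.sum_apply, Finset.sum_eq_single w]
  · have e : {x | Horo T.infty x t} =
        {x | T.level x = T.level (T.act t (List.ofFn w)) - n} := by
      ext x
      change Horo T.infty x t ↔ T.level x = _
      rw [horo_iff_level, level_act, List.length_ofFn, add_sub_cancel_right]
    change adjoint (T.word (List.ofFn w)) (T.coeff S (List.ofFn w) f) (T.act t (List.ofFn w)) = _
    rw [adjoint_word_apply_act _ _ rfl, if_pos rfl]
    change T.word (List.ofFn w) (S (restrictOp {x | Horo T.infty x t} f)) t = _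
    rw [word_apply, e]
  · intro w' _ hw
    change adjoint (T.word (List.ofFn w')) (T.coeff S (List.ofFn w') f)
      (T.act t (List.ofFn w)) = 0
    rw [adjoint_word_apply_act _ _ (by simp), if_neg fun h => hw (List.ofFn_injective h)]
  · exact fun h => absurd (Finset.mem_univ w) h

lemma diagonal_chi_of_eq {S : Op V} {n : ℕ} {s t : V} (h : T.level s = T.level t + n) :
    T.diagonal S n (chi t) s = S (chi t) s := by
  classical
  rw [diagonal_apply, restrictOp_chi, if_pos]
  change T.level t = T.level s - n
  omega

lemma diagonal_chi_of_ne {S : Op V} {n : ℕ} {s t : V} (h : T.level s ≠ T.level t + n) :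
    T.diagonal S n (chi t) s = 0 := by
  classical
  rw [diagonal_apply, restrictOp_chi, if_neg, map_zero]
  · rfl
  · change ¬ T.level t = T.level s - n
    omega

lemma norm_word_le (w : List (Fin q)) : ‖T.word w‖ ≤ 1 := by
  refine ContinuousLinearMap.opNorm_le_bound _ zero_le_one fun f => ?_
  rw [one_mul]
  induction w with
  | nil => exact le_of_eq (by simp [word])
  | cons j w ih =>
    have e : T.word (j :: w) f = T.alpha j (T.word w f) := by simp [word]
    rw [e]
    refine ((T.alpha j).le_of_opNorm_le (norm_compOp_le _ _) _).trans ?_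
    rwa [one_mul]

/-- The bound must be uniform in `n`, although there are `q^n` words. Any single word operator `U`
of length `n` satisfies `U U* = 1` and lowers levels by `n`, so the diagonal is the block diagonal
part of `S U`, times `U*`. -/
lemma norm_diagonal_le (hq : 1 ≤ q) (S : Op V) (n : ℕ) : ‖T.diagonal S n‖ ≤ ‖S‖ := by
  set w : List (Fin q) := List.replicate n ⟨0, hq⟩ with hw
  set U := T.word w
  have hU : ‖U‖ ≤ 1 := norm_word_le w
  have hU' : ‖adjoint U‖ ≤ 1 := by rwa [LinearIsometryEquiv.norm_map]
  have hUU : ∀ f, U (adjoint U f) = f := fun f => by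
    ext t
    rw [T.word_apply, adjoint_word_apply_act _ _ rfl, if_pos rfl]
  have key : T.diagonal S n = blockDiag T.horocycles (S * U) * adjoint U := by
    ext f s
    have e : restrictOp {x | T.level x = T.level s - n} f =
        U (restrictOp {x | Horo T.infty x s} (adjoint U f)) := by
      conv_lhs => rw [← hUU f]
      ext x
      rw [T.word_apply]
      change Set.indicator _ (fun x => U (adjoint U f) x) x = Set.indicator _ _ _
      simp only [Set.indicator_apply, Set.mem_ofPred_eq, horo_iff_level, level_act, hw,
        List.length_replicate, eq_sub_iff_add_eq]
      split_ifs
      · exact T.word_apply _ _ _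
      · rfl
    rw [diagonal_apply, e]
    rfl
  rw [key]
  calc ‖blockDiag T.horocycles (S * U) * adjoint U‖
      ≤ ‖blockDiag T.horocycles (S * U)‖ * ‖adjoint U‖ := norm_mul_le _ _
    _ ≤ ‖blockDiag T.horocycles (S * U)‖ := mul_le_of_le_one_right (norm_nonneg _) hU'
    _ ≤ ‖S * U‖ := LinearMap.mkContinuous_norm_le _ (norm_nonneg _) _
    _ ≤ ‖S‖ * ‖U‖ := norm_mul_le _ _
    _ ≤ ‖S‖ := mul_le_of_le_one_right (norm_nonneg _) hU

/-! ### The point evaluation -/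

variable {c : Fin q → Op V}

lemma summable_norm_pointEvalTerm (hq : 1 ≤ q) (hc : c ∈ T.ball) (F : Op V) :
    Summable fun n => ‖T.pointEvalTerm F c n‖ := by
  refine Summable.of_nonneg_of_le (fun _ => norm_nonneg _) (fun n => ?_)
    ((T.summable_norm_cAlpha_pow hc).mul_right ‖F‖)
  refine (norm_mul_le _ _).trans ?_
  gcongr
  exact norm_diagonal_le hq F n

lemma hasSum_pointEval (hq : 1 ≤ q) (hc : c ∈ T.ball) (F : Op V) :
    HasSum (fun n => T.cAlpha c ^ n * T.diagonal F n) (T.pointEval F c) :=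
  (Summable.of_norm (summable_norm_pointEvalTerm hq hc F)).hasSum

lemma pointEval_chi_of_ne (hq : 1 ≤ q) (hc : c ∈ T.ball) (F : Op V) {s t : V}
    (h : T.level s ≠ T.level t) : T.pointEval F c (chi t) s = 0 := by
  refine (hasSum_apply_apply (hasSum_pointEval hq hc F) (chi t) s).unique ?_
  convert hasSum_zero with n
  exact (shiftsLevel_cAlpha hc).pow n (T.level s + n) _
    (fun x hx => diagonal_chi_of_ne (by omega)) s (by ring)

/-- Since `a^n` lowers levels by exactly `n`, a level-preserving entry of `a^n F` sees only the
`n`-th diagonal of `F`. -/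
lemma pointEval_chi_of_eq (hq : 1 ≤ q) (hc : c ∈ T.ball) (F : Op V) {s t : V}
    (h : T.level s = T.level t) :
    T.pointEval F c (chi t) s = ((∑' n : ℕ, T.cAlpha c ^ n) * F) (chi t) s := by
  have h1 := hasSum_apply_apply (hasSum_pointEval hq hc F) (chi t) s
  have h2 := hasSum_apply_apply
    ((Summable.of_norm (T.summable_norm_cAlpha_pow hc)).hasSum.mul_right F) (chi t) s
  refine h1.unique ?_
  convert h2 using 2 with n
  have h3 := (shiftsLevel_cAlpha hc).pow n (T.level s + n) (T.diagonal F n (chi t) - F (chi t))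
    (fun x hx => by
      change T.diagonal F n (chi t) x - F (chi t) x = 0
      rw [diagonal_chi_of_eq (by omega), sub_self]) s (by ring)
  rw [map_sub] at h3
  exact sub_eq_zero.1 h3

lemma tsum_pow_eq_sum_add {A : Op V} (hA : Summable fun n => ‖A ^ n‖) (p : ℕ) :
    ∑' n : ℕ, A ^ n = ∑ n ∈ Finset.range p, A ^ n + A ^ p * ∑' n : ℕ, A ^ n := by
  have hs : Summable fun n => A ^ n := Summable.of_norm hA
  rw [← hs.tsum_mul_left, ← hs.sum_add_tsum_nat_add p]
  simp only [pow_add, (Commute.pow_pow_self A _ _).eq]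

/-- The point evaluation of `F` vanishes if and only if `(1 - c α)⁻¹ F` is strictly causal. -/
lemma pointEval_eq_zero_iff (hq : 1 ≤ q) (hc : c ∈ T.ball) {F : Op V} (hF : T.RaisesLevel 0 F) :
    T.pointEval F c = 0 ↔ T.RaisesLevel 1 ((∑' n : ℕ, T.cAlpha c ^ n) * F) := by
  constructor
  · intro h
    rw [raisesLevel_iff_chi]
    intro s t hst
    obtain ⟨p, hp⟩ : ∃ p : ℕ, T.level t = T.level s + p :=
      ⟨(T.level t - T.level s).toNat, by omega⟩
    -- At an entry that drops `p` levels, the terms `a^n F` with `n < p` vanish because `F` is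
    -- causal. The tail is `a^p` applied to `(1 - a)⁻¹F`, whose level-preserving part is `F^∧(c) =
    -- 0`.
    rw [tsum_pow_eq_sum_add (T.summable_norm_cAlpha_pow hc) p, add_mul, mul_assoc, Finset.sum_mul]
    have h1 : (∑ n ∈ Finset.range p, T.cAlpha c ^ n * F) (chi t) s = 0 := by
      rw [_root_.sum_apply, lp.coeFn_sum, Finset.sum_apply]
      refine Finset.sum_eq_zero fun n hn => ?_
      have hn' := Finset.mem_range.1 hn
      exact raisesLevel_iff_chi.1 (((raisesLevel_cAlpha hc).pow n).mul hF) s t (by omega)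
    have h2 : (T.cAlpha c ^ p * ((∑' n : ℕ, T.cAlpha c ^ n) * F)) (chi t) s = 0 := by
      refine (shiftsLevel_cAlpha hc).pow p (T.level t) _ (fun x hx => ?_) s (by omega)
      have hx' := pointEval_chi_of_eq hq hc F hx
      rw [h] at hx'
      exact hx'.symm
    change (∑ n ∈ Finset.range p, T.cAlpha c ^ n * F) (chi t) s +
      (T.cAlpha c ^ p * ((∑' n : ℕ, T.cAlpha c ^ n) * F)) (chi t) s = 0
    rw [h1, h2, add_zero]
  · intro h
    refine ext_chi fun t => ?_
    ext s
    by_cases hs : T.level s = T.level t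
    · rw [pointEval_chi_of_eq hq hc F hs]
      exact raisesLevel_iff_chi.1 h s t (by omega)
    · exact pointEval_chi_of_ne hq hc F hs

/-! ### Division by the Blaschke factor -/

/-- The operator `α* B_c* F`. -/
noncomputable def quotient (T : ShiftTree V q) (c : Fin q → Op V) (F : Op V) : Op V :=
  opSqrt (gramMiddle (T.cAlpha c)) * star (blaschkeResolvent (T.cAlpha c)) *
    (1 - star (T.cAlpha c)) * F

lemma adjoint_blaschke_comp (hc : c ∈ T.ball) (F : Op V) :
    adjoint (T.blaschke c) ∘L F = colOp fun j => T.alpha j * T.quotient c F := by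
  rw [adjoint_blaschke hc]
  rfl

lemma quotient_eq (hc : c ∈ T.ball) (F : Op V) :
    T.quotient c F = opSqrt (gramMiddle (T.cAlpha c)) *
      Ring.inverse (gramSeries (T.cAlpha c)) *
      ((∑' n : ℕ, T.cAlpha c ^ n) * F - gramSeries (T.cAlpha c) * star (T.cAlpha c) * F) := by
  have h := tsum_pow_mul_gramSeries (T.summable_norm_cAlpha_pow hc)
  rw [quotient, blaschkeResolvent, ← sub_mul, ← h]
  simp only [star_mul, star_star, star_gramSeries, star_inverse_gramSeries, mul_assoc]

/-- In `quotient_eq` the prefactor `√m r⁻¹` and its inverse are causal, and the subtracted term is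
strictly causal, so neither affects strict causality. -/
lemma raisesLevel_quotient_iff (hc : c ∈ T.ball) {F : Op V} (hF : T.RaisesLevel 0 F) :
    T.RaisesLevel 1 (T.quotient c F) ↔
      T.RaisesLevel 1 ((∑' n : ℕ, T.cAlpha c ^ n) * F) := by
  have ha := T.summable_norm_cAlpha_pow hc
  have hm := raisesLevel_gramMiddle hc
  have hN : T.RaisesLevel 0 (opSqrt (gramMiddle (T.cAlpha c))) :=
    raisesLevel_opSqrt hm (by rwa [star_gramMiddle])
  have hN' : T.RaisesLevel 0 (Ring.inverse (opSqrt (gramMiddle (T.cAlpha c)))) := by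
    refine raisesLevel_inverse hN ?_
    change T.RaisesLevel 0 (adjoint (opSqrt (gramMiddle (T.cAlpha c))))
    rwa [adjoint_opSqrt]
  have hR := raisesLevel_gramSeries hc
  have hR' := raisesLevel_inverse_gramSeries hc
  have hd : T.RaisesLevel 1 (gramSeries (T.cAlpha c) * star (T.cAlpha c) * F) :=
    (hR.mul (raisesLevel_star_cAlpha hc)).mul hF
  have k1 := Ring.mul_inverse_cancel _ (isUnit_gramSeries ha)
  have k2 : Ring.inverse (opSqrt (gramMiddle (T.cAlpha c))) * opSqrt (gramMiddle (T.cAlpha c)) = 1 :=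
    Ring.inverse_mul_cancel _ (isUnit_opSqrt (gramMiddle_nonneg ha) (isUnit_gramMiddle ha))
  have hq := quotient_eq hc F
  constructor
  · intro h
    have e : (∑' n : ℕ, T.cAlpha c ^ n) * F =
        gramSeries (T.cAlpha c) * Ring.inverse (opSqrt (gramMiddle (T.cAlpha c))) *
          T.quotient c F + gramSeries (T.cAlpha c) * star (T.cAlpha c) * F := by
      rw [hq]
      simp only [← mul_assoc]
      rw [mul_assoc (gramSeries (T.cAlpha c)) _ (opSqrt _), k2, mul_one, k1, one_mul,
        sub_add_cancel]
    rw [e]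
    exact ((hR.mul hN').mul h).add hd
  · intro h
    rw [hq]
    exact (hN.mul hR').mul (h.sub hd)

end ShiftTree

/-! ### Hilbert–Schmidt norms -/

section HilbertSchmidt

variable {V : Type*} {q : ℕ}

lemma hsNorm_sq (F : Op V) : hsNorm F ^ 2 = ∑' t, ENNReal.ofReal (‖F (chi t)‖ ^ 2) := by
  rw [hsNorm, trace, ← ENNReal.rpow_natCast, ← ENNReal.rpow_mul, Nat.cast_ofNat,
    one_div_mul_cancel two_ne_zero, ENNReal.rpow_one]
  refine tsum_congr fun t => ?_
  change ENNReal.ofReal (RCLike.re (inner ℂ (chi t) (adjoint F (F (chi t))))) = _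
  rw [ContinuousLinearMap.adjoint_inner_right, inner_self_eq_norm_sq]

lemma sum_hsNorm_sq (G : Fin q → Op V) :
    ∑ j, hsNorm (G j) ^ 2 = ∑' t, ENNReal.ofReal (‖colOp G (chi t)‖ ^ 2) := by
  simp only [hsNorm_sq]
  rw [← Summable.tsum_finsetSum fun _ _ => ENNReal.summable]
  refine tsum_congr fun t => ?_
  rw [PiLp.norm_sq_eq_of_L2, ENNReal.ofReal_sum_of_nonneg fun _ _ => by positivity]
  rfl

/-- An isometry preserves the norm of the image of each basis vector. -/
lemma sum_hsNorm_sq_eq {B : L2q V q →L[ℂ] L2 V}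
    (hB : adjoint B ∘L B = ContinuousLinearMap.id ℂ (L2q V q)) (G : Fin q → Op V) :
    ∑ j, hsNorm (G j) ^ 2 = hsNorm (B ∘L colOp G) ^ 2 := by
  rw [sum_hsNorm_sq, hsNorm_sq]
  refine tsum_congr fun t => ?_
  have := (ContinuousLinearMap.norm_map_iff_adjoint_comp_self B).2 hB
  rw [ContinuousLinearMap.comp_apply, this]

end HilbertSchmidt

end Multiscale

theorem theorem7p3 {V : Type*} (q : ℕ) (hq : 1 ≤ q) (T : Multiscale.ShiftTree V q)
    (c : Fin q → Multiscale.Op V) (hc : c ∈ T.ball) :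
    (ContinuousLinearMap.adjoint (T.blaschke c) ∘L T.blaschke c =
        ContinuousLinearMap.id ℂ (Multiscale.L2q V q) ∧
      T.blaschke c ∘L ContinuousLinearMap.adjoint (T.blaschke c) =
        ContinuousLinearMap.id ℂ (Multiscale.L2 V)) ∧
    ∀ F ∈ T.H2,
      (Summable fun n => ‖T.pointEvalTerm F c n‖) ∧
      (T.pointEval F c = 0 ↔
        ∃ G : Fin q → Multiscale.Op V, (∀ j, G j ∈ T.H2) ∧
          F = T.blaschke c ∘L Multiscale.colOp G ∧
          Multiscale.hsNormTuple G = Multiscale.hsNorm F) := by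
  open Multiscale Multiscale.ShiftTree in
  have h1 := adjoint_comp_blaschke hc
  have h2 := blaschke_comp_adjoint hc
  refine ⟨⟨h1, h2⟩, fun F hF => ⟨summable_norm_pointEvalTerm hq hc F, ?_⟩⟩
  have hF0 := isCausal_iff.1 hF.1
  rw [pointEval_eq_zero_iff hq hc hF0, ← raisesLevel_quotient_iff hc hF0, raisesLevel_one_iff]
  constructor
  · intro h
    have hFG : F = T.blaschke c ∘L colOp fun j => T.alpha j * T.quotient c F := by
      rw [← adjoint_blaschke_comp hc, ← ContinuousLinearMap.comp_assoc, h2,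
        ContinuousLinearMap.id_comp]
    have hsum := sum_hsNorm_sq_eq h1 fun j => T.alpha j * T.quotient c F
    rw [← hFG] at hsum
    refine ⟨_, fun j => ⟨isCausal_iff.2 (h j), ?_⟩, hFG, ?_⟩
    · have : hsNorm (T.alpha j * T.quotient c F) ^ 2 ≤ hsNorm F ^ 2 := by
        rw [← hsum]
        exact Finset.single_le_sum
          (f := fun j => hsNorm (T.alpha j * T.quotient c F) ^ 2)
          (fun _ _ => zero_le) (Finset.mem_univ j)
      exact ((ENNReal.pow_le_pow_left_iff two_ne_zero).1 this).trans_lt hF.2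
    · rw [hsNormTuple, hsum, ← ENNReal.rpow_natCast, ← ENNReal.rpow_mul]
      norm_num
  · rintro ⟨G, hG, hFG, -⟩ j
    -- Since `B_c* B_c = 1`, any factor `G` equals `B_c* F`.
    have e : colOp G = colOp fun j => T.alpha j * T.quotient c F := by
      rw [← adjoint_blaschke_comp hc, hFG, ← ContinuousLinearMap.comp_assoc, h1,
        ContinuousLinearMap.id_comp]
    have ej : G j = T.alpha j * T.quotient c F := by
      ext1 f
      exact congrArg (fun g : L2q V q => g j) (DFunLike.congr_fun e f)
    rw [← ej]
    exact isCausal_iff.1 (hG j).1
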